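/- **Setting.** Let $X$ be a (Hausdorff, second countable, finite-dimensional, boundaryless) smooth manifold, $\omega$ a closed $3$-form on $X$ (a pre-2-plectic form), and $\mathcal U=(U_i)_{i\in I}$ an open cover of $X$. Write $\check C^p(\Omega^k)$ for the \v{C}ech $p$-cochains of $\mathcal U$ with values in $k$-forms (families of $k$-forms on the $(p+1)$-fold intersections indexed by $I^{p+1}$), $\delta$ for the \v{C}ech differential, $\mathcal L_v=d\iota_v+\iota_v d$, and $\iota_{v_1\wedge v_2}=\iota_{v_2}\iota_{v_1}$, $\iota_{v_1\wedge v_2\wedge v_3}=\iota_{v_3}\iota_{v_2}\iota_{v_1}$. Let $\bar A=(A^2,A^1,A^0)$ be a \v{C}ech–Deligne 2-cocycle, i.e. $A^2\in\check C^0(\Omega^2)$, $A^1\in\check C^1(\Omega^1)$, $A^0$ a 2-cochain of smooth $U(1)$-valued functions, with $\delta A^2=dA^1$, $\delta A^1=-\operatorname{dlog}A^0$, $\delta A^0=1$, where $\operatorname{dlog}g=\frac1{2\pi i}g^{-1}dg$. Suppose that $\bar A$ prequantizes $\omega$: $dA^2=\omega$ on each $U_i$. Put $\mathcal L_vA^0:=\iota_v\operatorname{dlog}A^0$.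 **Lie 2-algebras.** A Lie 2-algebra is an $L_\infty$-algebra concentrated in degrees $0,1$. Consider the following two-term complexes and brackets, where the brackets not listed vanish or are determined by graded skew-symmetry; $v,v_i$ are vector fields. * $L_\infty(X,\omega)$: degree 0: $\{v+H\in\mathfrak X(X)\oplus\Omega^1(X):\iota_v\omega+dH=0\}$; degree 1: $\eta\in C^\infty(X)$; $\partial\eta=0+d\eta$; $[v_1+H_1,v_2+H_2]=[v_1,v_2]+\iota_{v_1\wedge v_2}\omega$; $[v+H,\eta]=0$; $l_3=-\iota_{v_1\wedge v_2\wedge v_3}\omega$. * $\mathfrak{courant}(X,\omega)$: degree 0: $\mathfrak X(X)\oplus\Omega^1(X)$; degree 1: $C^\infty(X)$; $\partial\eta=0+d\eta$; $[v_1+\theta_1,v_2+\theta_2]=[v_1,v_2]+\mathcal L_{v_1}\theta_2-\mathcal L_{v_2}\theta_1-\frac12d(\iota_{v_1}\theta_2-\iota_{v_2}\theta_1)-\iota_{v_1\wedge v_2}\omega$; $[v+\theta,\eta]=\frac12\iota_vd\eta$; $l_3(x_1,x_2,x_3)=-\frac16\big(\langle[x_1,x_2],x_3\rangle+\text{cyc.}\big)$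 with $\langle v_1+\theta_1,v_2+\theta_2\rangle=\iota_{v_1}\theta_2+\iota_{v_2}\theta_1$. * $\mathfrak{atiyah}(X,\omega)$: degree 0: $\mathfrak X(X)$; degree 1: $C^\infty(X)$; $\partial=0$; $[v_1,v_2]$ the Lie bracket; $[v,\eta]=\mathcal L_v\eta$; $l_3=-\iota_{v_1\wedge v_2\wedge v_3}\omega$. * $\mathrm{dgLie}_{\mathrm{Qu}}(X,\bar A)$: degree 0: the $v+\theta^1+\theta^0\in\mathfrak X(X)\oplus\check C^0(\Omega^1)\oplus\check C^1(\Omega^0)$ with $\mathcal L_vA^2=d\theta^1$, $\mathcal L_vA^1=\delta\theta^1-d\theta^0$, $\mathcal L_vA^0=\delta\theta^0$; degree 1: $\eta\in\check C^0(\Omega^0)$; $\partial\eta=0+d\eta+\delta\eta$. * $\mathrm{dgLie}_{\mathrm{Cou}}(X,\bar A)$: the same with the condition $\mathcal L_vA^2=d\theta^1$ omitted. * $\mathrm{dgLie}_{\mathrm{At}}(X,\bar A)$: degree 0: the $v+\theta^0\in\mathfrak X(X)\oplus\check C^1(\Omega^0)$ with $\mathcal L_vA^0=\delta\theta^0$;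 degree 1: $\check C^0(\Omega^0)$; $\partial\eta=0+\delta\eta$. In the last three, $[v_1+\bar\theta_1,v_2+\bar\theta_2]=[v_1,v_2]+\mathcal L_{v_1}\bar\theta_2-\mathcal L_{v_2}\bar\theta_1$, $[v+\bar\theta,\eta]=\mathcal L_v\eta$ and $l_3=0$. **Maps.** Suppressing restrictions of global forms to the $U_i$, define maps with linear part $(\cdot)_1$ and binary part $(\cdot)_2$: * $\phi:L_\infty(X,\omega)\to\mathfrak{courant}(X,\omega)$: $\phi_1$ the inclusion, $\phi_2=-\frac12(\iota_{v_1}\theta_2-\iota_{v_2}\theta_1)$; * $\psi:\mathfrak{courant}(X,\omega)\to\mathfrak{atiyah}(X,\omega)$: $\psi_1(v+\theta)=v$, $\psi_1(\eta)=\eta$, $\psi_2=-\frac12(\iota_{v_1}\theta_2-\iota_{v_2}\theta_1)$; * $i:\mathrm{dgLie}_{\mathrm{Qu}}\to\mathrm{dgLie}_{\mathrm{Cou}}$ the inclusion, and $p:\mathrm{dgLie}_{\mathrm{Cou}}\to\mathrm{dgLie}_{\mathrm{At}}$ the map forgetting $\theta^1$ (binary parts zero); * $f:L_\infty(X,\omega)\to\mathrm{dgLie}_{\mathrm{Qu}}$: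 $f_1(v+\theta)=v-\theta+\iota_v(A^2-A^1)$, $f_1(\eta)=-\eta$, $f_2=\iota_{v_1}\theta_2-\iota_{v_2}\theta_1+\iota_{v_1\wedge v_2}A^2$; * $f^{\mathfrak c}:\mathfrak{courant}(X,\omega)\to\mathrm{dgLie}_{\mathrm{Cou}}$: $f^{\mathfrak c}_1(v+\theta)=v-\theta+\iota_v(A^2-A^1)$, $f^{\mathfrak c}_1(\eta)=-\eta$, $f^{\mathfrak c}_2=\frac12(\iota_{v_1}\theta_2-\iota_{v_2}\theta_1)+\iota_{v_1\wedge v_2}A^2$; * $f^{\mathfrak a}:\mathfrak{atiyah}(X,\omega)\to\mathrm{dgLie}_{\mathrm{At}}$: $f^{\mathfrak a}_1(v)=v-\iota_vA^1$, $f^{\mathfrak a}_1(\eta)=-\eta$, $f^{\mathfrak a}_2=\iota_{v_1\wedge v_2}A^2$. **Proposition.** All six objects are Lie 2-algebras; $\phi,\psi,i,p$ are $L_\infty$-morphisms; $f$, $f^{\mathfrak c}$ and $f^{\mathfrak a}$ are weak equivalences, i.e. $L_\infty$-morphisms whose linear parts are quasi-isomorphisms; and the ladder $$L_\infty(X,\omega)\xrightarrow{\phi}\mathfrak{courant}(X,\omega)\xrightarrow{\psi}\mathfrak{atiyah}(X,\omega),\qquad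 \mathrm{dgLie}_{\mathrm{Qu}}\xrightarrow{i}\mathrm{dgLie}_{\mathrm{Cou}}\xrightarrow{p}\mathrm{dgLie}_{\mathrm{At}}$$ commutes strictly as a diagram of $L_\infty$-morphisms: $f^{\mathfrak c}\circ\phi=i\circ f$ and $f^{\mathfrak a}\circ\psi=p\circ f^{\mathfrak c}$. -/

import Mathlib

open scoped Manifold ContDiff Topology
open TopologicalSpace (Opens)

noncomputable section

namespace HigherPrequantum

set_option linter.unusedSectionVars false

section Cartan
variable {E : Type*} [NormedAddCommGroup E] [NormedSpace ℝ E]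

theorem contDiffAt_extDeriv {k : ℕ} {a : E → E [⋀^Fin k]→L[ℝ] ℝ} {y : E}
    (ha : ContDiffAt ℝ ∞ a y) : ContDiffAt ℝ ∞ (extDeriv a) y := by
  have h := ha.fderiv_right (m := ∞) (by simp)
  exact h.continuousLinearMap_comp (ContinuousAlternatingMap.alternatizeUncurryFinCLM ℝ E ℝ)

/-- `curryLeft` as a continuous linear map. -/
def curryLeftCLM {k : ℕ} : (E [⋀^Fin (k + 1)]→L[ℝ] ℝ) →L[ℝ] (E →L[ℝ] E [⋀^Fin k]→L[ℝ] ℝ) :=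
  (ContinuousAlternatingMap.curryLeftLI (𝕜 := ℝ) (E := E) (F := ℝ)
    (n := k)).toContinuousLinearMap

theorem contDiffAt_curryLeft {k : ℕ} {a : E → E [⋀^Fin (k + 1)]→L[ℝ] ℝ} {v : E → E} {y : E}
    (ha : ContDiffAt ℝ ∞ a y) (hv : ContDiffAt ℝ ∞ v y) :
    ContDiffAt ℝ ∞ (fun z => (a z).curryLeft (v z)) y := by
  have h : ContDiffAt ℝ ∞ (fun z => curryLeftCLM (a z)) y := by fun_prop
  exact h.clm_apply hv

theorem hasFDerivAt_clm_comp {G H : Type*} [NormedAddCommGroup G] [NormedSpace ℝ G]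
    [NormedAddCommGroup H] [NormedSpace ℝ H] (L : G →L[ℝ] H) {a : E → G} {y : E}
    (ha : DifferentiableAt ℝ a y) :
    HasFDerivAt (fun z => L (a z)) (L.comp (fderiv ℝ a y)) y :=
  L.hasFDerivAt.comp y ha.hasFDerivAt

theorem fderiv_curryLeft {k : ℕ} {a : E → E [⋀^Fin (k + 1)]→L[ℝ] ℝ} {u : E → E} {y : E}
    (ha : DifferentiableAt ℝ a y) (hu : DifferentiableAt ℝ u y) (h : E) :
    fderiv ℝ (fun z => (a z).curryLeft (u z)) y h =
      (fderiv ℝ a y h).curryLeft (u y) + (a y).curryLeft (fderiv ℝ u y h) := by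
  have h1 := hasFDerivAt_clm_comp (H := E →L[ℝ] E [⋀^Fin k]→L[ℝ] ℝ) curryLeftCLM ha
  have h2 := (h1.clm_apply hu.hasFDerivAt).fderiv
  have h3 : (fun z => (a z).curryLeft (u z)) = (fun z => curryLeftCLM (a z) (u z)) := rfl
  rw [h3, h2]
  simp [add_comm, curryLeftCLM]

/-- The classical coordinate expression of the Lie derivative. -/
def lieModel {k : ℕ} (u : E → E) (a : E → E [⋀^Fin k]→L[ℝ] ℝ) (y : E) (w : Fin k → E) : ℝ :=
  fderiv ℝ a y (u y) w + ∑ i : Fin k, a y (Function.update w i (fderiv ℝ u y (w i)))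

theorem lieModel_zero (u : E → E) (a : E → E [⋀^Fin 0]→L[ℝ] ℝ) (y : E) (w : Fin 0 → E) :
    (extDeriv a y).curryLeft (u y) w = lieModel u a y w := by
  simp only [lieModel, ContinuousAlternatingMap.curryLeft_apply_apply, extDeriv,
    ContinuousAlternatingMap.alternatizeUncurryFin_apply]
  simp [Subsingleton.elim _ w]

theorem lieModel_succ {k : ℕ} {a : E → E [⋀^Fin (k + 1)]→L[ℝ] ℝ} {u : E → E} {y : E}
    (ha : DifferentiableAt ℝ a y) (hu : DifferentiableAt ℝ u y) (w : Fin (k + 1) → E) :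
    extDeriv (fun z => (a z).curryLeft (u z)) y w + (extDeriv a y).curryLeft (u y) w =
      lieModel u a y w := by
  simp only [lieModel, ContinuousAlternatingMap.curryLeft_apply_apply, extDeriv,
    ContinuousAlternatingMap.alternatizeUncurryFin_apply, fderiv_curryLeft ha hu]
  rw [Fin.sum_univ_succ (n := k + 1)]
  have h1 : ∀ i : Fin (k + 1), Fin.removeNth i.succ (Matrix.vecCons (u y) w) =
      Matrix.vecCons (u y) (i.removeNth w) := by
    intro i
    ext j
    refine Fin.cases ?_ (fun j => ?_) j <;> simp [Fin.removeNth]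
  have h2 : ∀ i : Fin (k + 1), (-1 : ℝ) ^ (i : ℕ) *
      a y (Matrix.vecCons (fderiv ℝ u y (w i)) (i.removeNth w)) =
      a y (Function.update w i (fderiv ℝ u y (w i))) := by
    intro i
    have := (a y).map_insertNth i (fderiv ℝ u y (w i)) (i.removeNth w)
    rw [Fin.insertNth_removeNth] at this
    rw [this]; simp
  have h3 : Fin.removeNth 0 (Matrix.vecCons (u y) w) = w := by
    ext j; simp [Fin.removeNth]
  simp only [h1, h3, ContinuousAlternatingMap.add_apply,
    ContinuousAlternatingMap.curryLeft_apply_apply, smul_add, Finset.sum_add_distrib,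
    Matrix.cons_val_zero, Matrix.cons_val_succ, Fin.val_succ, pow_succ]
  simp [← h2]
  ring

theorem cartan_model {k : ℕ} {a : E → E [⋀^Fin (k + 1)]→L[ℝ] ℝ} {u v : E → E} {y : E}
    (ha : DifferentiableAt ℝ a y) (hv : DifferentiableAt ℝ v y) (w : Fin k → E) :
    (a y).curryLeft (VectorField.lieBracket ℝ u v y) w =
      lieModel u (fun z => (a z).curryLeft (v z)) y w - lieModel u a y (Matrix.vecCons (v y) w) := by
  have h1 : ∀ (i : Fin k) (x : E), Function.update (Matrix.vecCons (v y) w) i.succ x =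
      Matrix.vecCons (v y) (Function.update w i x) := by
    intro i x
    ext j
    refine Fin.cases ?_ (fun j => ?_) j
    · simp [Function.update, (Fin.succ_ne_zero i).symm]
    · simp [Function.update]
  have h0 : ∀ x : E, Function.update (Matrix.vecCons (v y) w) 0 x = Matrix.vecCons x w := by
    intro x
    ext j
    refine Fin.cases ?_ (fun j => ?_) j <;> simp [Function.update]
  simp only [lieModel, fderiv_curryLeft ha hv, Fin.sum_univ_succ (n := k), h1, h0,
    VectorField.lieBracket, map_sub]
  simp
  ring

end Cartan

section Forms

variable {E X : Type*} [NormedAddCommGroup E] [NormedSpace ℝ E] [TopologicalSpace X]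
  [ChartedSpace E X]

/-- Alternating `k`-linear forms on the tangent space at `x`. -/
abbrev AltAt (E : Type*) {X : Type*} [NormedAddCommGroup E] [NormedSpace ℝ E] [TopologicalSpace X]
    [ChartedSpace E X] (k : ℕ) (x : X) : Type _ :=
  (TangentSpace 𝓘(ℝ, E) x) [⋀^Fin k]→L[ℝ] ℝ

/-- The local representative of a field of alternating forms in the chart at `x₀`, i.e. its
pullback along the inverse of that chart. -/
def chartRep {k : ℕ} (x₀ : X) (α : ∀ x : X, AltAt E k x) : E → E [⋀^Fin k]→L[ℝ] ℝ :=
  fun y => (α ((chartAt E x₀).symm y)).compContinuousLinearMap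
    (mfderiv 𝓘(ℝ, E) 𝓘(ℝ, E) (chartAt E x₀).symm y)

/-- Smoothness of a field of alternating forms on `U`: all local representatives are smooth. -/
def IsSmoothOn {k : ℕ} (U : Set X) (α : ∀ x : X, AltAt E k x) : Prop :=
  ∀ x₀ : X, ContDiffOn ℝ ∞ (chartRep x₀ α) ((chartAt E x₀).target ∩ (chartAt E x₀).symm ⁻¹' U)

/-- The exterior derivative, computed at `x` in the chart at `x`. -/
def extDerivAt {k : ℕ} (α : ∀ x : X, AltAt E k x) (x : X) : AltAt E (k + 1) x :=
  (extDeriv (chartRep x α) (chartAt E x x)).compContinuousLinearMap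
    (mfderiv 𝓘(ℝ, E) 𝓘(ℝ, E) (chartAt E x) x)

theorem chartRep_add {k : ℕ} (x₀ : X) (α β : ∀ x : X, AltAt E k x) :
    chartRep x₀ (α + β) = chartRep x₀ α + chartRep x₀ β := rfl

theorem chartRep_smul {k : ℕ} (x₀ : X) (c : ℝ) (α : ∀ x : X, AltAt E k x) :
    chartRep x₀ (c • α) = c • chartRep x₀ α := rfl

theorem chartRep_congr {k : ℕ} {x₀ : X} {α β : ∀ x : X, AltAt E k x} {y : E}
    (h : α ((chartAt E x₀).symm y) = β ((chartAt E x₀).symm y)) :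
    chartRep x₀ α y = chartRep x₀ β y := by
  simp only [chartRep, h]

theorem isOpen_chart_preimage (x₀ : X) {U : Set X} (hU : IsOpen U) :
    IsOpen ((chartAt E x₀).target ∩ (chartAt E x₀).symm ⁻¹' U) :=
  (chartAt E x₀).symm.isOpen_inter_preimage hU

theorem IsSmoothOn.contDiffAt {k : ℕ} {U : Set X} (hU : IsOpen U) {α : ∀ x : X, AltAt E k x}
    (hα : IsSmoothOn U α) {x₀ : X} {y : E} (hy : y ∈ (chartAt E x₀).target)
    (hyU : (chartAt E x₀).symm y ∈ U) : ContDiffAt ℝ ∞ (chartRep x₀ α) y :=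
  (hα x₀).contDiffAt ((isOpen_chart_preimage x₀ hU).mem_nhds ⟨hy, hyU⟩)

theorem IsSmoothOn.congr {k : ℕ} {U : Set X} {α β : ∀ x : X, AltAt E k x}
    (hα : IsSmoothOn U α) (h : ∀ x ∈ U, β x = α x) : IsSmoothOn U β :=
  fun x₀ => (hα x₀).congr fun _ hy => chartRep_congr (h _ hy.2)

theorem IsSmoothOn.mono {k : ℕ} {U V : Set X} {α : ∀ x : X, AltAt E k x}
    (hα : IsSmoothOn U α) (h : V ⊆ U) : IsSmoothOn V α :=
  fun x₀ => (hα x₀).mono fun _ hy => ⟨hy.1, h hy.2⟩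

variable [IsManifold 𝓘(ℝ, E) ∞ X]

theorem chartRep_apply_mfderiv {k : ℕ} (x₀ : X) (α : ∀ x : X, AltAt E k x) {p : X}
    (hp : p ∈ (chartAt E x₀).source) (w : Fin k → TangentSpace 𝓘(ℝ, E) p) :
    chartRep x₀ α (chartAt E x₀ p)
      (fun i => mfderiv 𝓘(ℝ, E) 𝓘(ℝ, E) (chartAt E x₀) p (w i)) = α p w := by
  have h := (mdifferentiable_chart (I := 𝓘(ℝ, E)) x₀).symm_comp_deriv hp
  have h' : ∀ w : TangentSpace 𝓘(ℝ, E) p, mfderiv 𝓘(ℝ, E) 𝓘(ℝ, E) (chartAt E x₀).symm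
      (chartAt E x₀ p) (mfderiv 𝓘(ℝ, E) 𝓘(ℝ, E) (chartAt E x₀) p w) = w :=
    fun w => congrArg (fun L => L w) h
  have key : ∀ q : X, q = p → ∀ a b : Fin k → E, a = b →
      (show E [⋀^Fin k]→L[ℝ] ℝ from α q) a = (show E [⋀^Fin k]→L[ℝ] ℝ from α p) b := by
    rintro q rfl a b rfl; rfl
  exact key _ ((chartAt E x₀).left_inv hp) _ _ (funext fun i => h' (w i))

theorem eq_of_chartRep_eq {k : ℕ} {x : X} {α β : ∀ x : X, AltAt E k x}
    (h : chartRep x α (chartAt E x x) = chartRep x β (chartAt E x x)) : α x = β x := by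
  ext w
  rw [← chartRep_apply_mfderiv x α (mem_chart_source E x) w, h,
    chartRep_apply_mfderiv x β (mem_chart_source E x) w]

theorem chartRep_transition {k : ℕ} (x₀ x₁ : X) (α : ∀ x : X, AltAt E k x) {y : E}
    (hy : y ∈ (chartAt E x₀).target) (hy₁ : (chartAt E x₀).symm y ∈ (chartAt E x₁).source) :
    chartRep x₀ α y = (chartRep x₁ α (chartAt E x₁ ((chartAt E x₀).symm y))).compContinuousLinearMap
      (fderiv ℝ (chartAt E x₁ ∘ (chartAt E x₀).symm) y) := by
  have hτ : fderiv ℝ (chartAt E x₁ ∘ (chartAt E x₀).symm) y =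
      (mfderiv 𝓘(ℝ, E) 𝓘(ℝ, E) (chartAt E x₁) ((chartAt E x₀).symm y)).comp
        (mfderiv 𝓘(ℝ, E) 𝓘(ℝ, E) (chartAt E x₀).symm y) := by
    rw [← mfderiv_eq_fderiv]
    exact mfderiv_comp (I' := 𝓘(ℝ, E)) y ((mdifferentiable_chart x₁).mdifferentiableAt hy₁)
      ((mdifferentiable_chart x₀).mdifferentiableAt_symm hy)
  ext w
  have h := chartRep_apply_mfderiv x₁ α hy₁
    (fun i => mfderiv 𝓘(ℝ, E) 𝓘(ℝ, E) (chartAt E x₀).symm y (w i))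
  rw [hτ]
  exact h.symm

theorem contDiffAt_transition (x₀ x₁ : X) {y : E}
    (hy : y ∈ (chartAt E x₀).target) (hy₁ : (chartAt E x₀).symm y ∈ (chartAt E x₁).source) :
    ContDiffAt ℝ ∞ (chartAt E x₁ ∘ (chartAt E x₀).symm) y := by
  rw [← contMDiffAt_iff_contDiffAt]
  exact (contMDiffAt_of_mem_maximalAtlas (IsManifold.chart_mem_maximalAtlas x₁) hy₁).comp y
    (contMDiffAt_symm_of_mem_maximalAtlas (IsManifold.chart_mem_maximalAtlas x₀) hy)

theorem chartRep_extDerivAt {k : ℕ} {U : Set X} (hU : IsOpen U) {α : ∀ x : X, AltAt E k x}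
    (hα : IsSmoothOn U α) {x₀ : X} {y : E} (hy : y ∈ (chartAt E x₀).target)
    (hyU : (chartAt E x₀).symm y ∈ U) :
    chartRep x₀ (extDerivAt α) y = extDeriv (chartRep x₀ α) y := by
  set p := (chartAt E x₀).symm y with hp
  have hps : p ∈ (chartAt E p).source := mem_chart_source E p
  have hev : chartRep x₀ α =ᶠ[𝓝 y] fun z =>
      (chartRep p α ((chartAt E p ∘ (chartAt E x₀).symm) z)).compContinuousLinearMap
        (fderiv ℝ (chartAt E p ∘ (chartAt E x₀).symm) z) := by
    filter_upwards [(isOpen_chart_preimage x₀ (chartAt E p).open_source).mem_nhds ⟨hy, hps⟩]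
      with z hz
    exact chartRep_transition x₀ p α hz.1 hz.2
  have hsm : ContDiffAt ℝ ∞ (chartRep p α) (chartAt E p p) :=
    hα.contDiffAt hU (mem_chart_target E p) (by rwa [(chartAt E p).left_inv hps])
  have hpb := extDeriv_pullback (r := ∞) (f := chartAt E p ∘ (chartAt E x₀).symm) (x := y)
    (show DifferentiableAt ℝ (chartRep p α) ((chartAt E p ∘ (chartAt E x₀).symm) y) from
      hsm.differentiableAt (by simp)) (contDiffAt_transition x₀ p hy hps)
    (by simp only [minSmoothness_of_isRCLikeNormedField]; exact ENat.LEInfty.out)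
  rw [hev.extDeriv_eq, hpb]
  have hτ : fderiv ℝ (chartAt E p ∘ (chartAt E x₀).symm) y =
      (mfderiv 𝓘(ℝ, E) 𝓘(ℝ, E) (chartAt E p) ((chartAt E x₀).symm y)).comp
        (mfderiv 𝓘(ℝ, E) 𝓘(ℝ, E) (chartAt E x₀).symm y) := by
    rw [← mfderiv_eq_fderiv]
    exact mfderiv_comp (I' := 𝓘(ℝ, E)) y ((mdifferentiable_chart p).mdifferentiableAt hps)
      ((mdifferentiable_chart x₀).mdifferentiableAt_symm hy)
  rw [hτ]
  rfl

theorem IsSmoothOn.extDerivAt {k : ℕ} {U : Set X} (hU : IsOpen U) {α : ∀ x : X, AltAt E k x}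
    (hα : IsSmoothOn U α) : IsSmoothOn U (extDerivAt α) := fun _ _ hy =>
  ((contDiffAt_extDeriv (hα.contDiffAt hU hy.1 hy.2)).contDiffWithinAt.congr
    (fun _ hz => chartRep_extDerivAt hU hα hz.1 hz.2) (chartRep_extDerivAt hU hα hy.1 hy.2))

theorem extDerivAt_congr {k : ℕ} {U : Set X} (hU : IsOpen U) {α β : ∀ x : X, AltAt E k x}
    (h : ∀ x ∈ U, α x = β x) {x : X} (hx : x ∈ U) :
    extDerivAt α x = extDerivAt β x := by
  have : chartRep x α =ᶠ[𝓝 (chartAt E x x)] chartRep x β := by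
    filter_upwards [(isOpen_chart_preimage x hU).mem_nhds ⟨mem_chart_target E x,
      by simpa using hx⟩] with z hz
    exact chartRep_congr (h _ hz.2)
  simp only [extDerivAt, this.extDeriv_eq]

/-- Interior product, pointwise. -/
def interiorAt {k : ℕ} (v : ∀ x : X, TangentSpace 𝓘(ℝ, E) x) (α : ∀ x : X, AltAt E (k + 1) x)
    (x : X) : AltAt E k x :=
  (show E [⋀^Fin (k + 1)]→L[ℝ] ℝ from α x).curryLeft (v x)

/-- The local representative of a vector field in the chart at `x₀`. -/
def vecRep (x₀ : X) (v : ∀ x : X, TangentSpace 𝓘(ℝ, E) x) : E → E :=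
  VectorField.mpullback 𝓘(ℝ, E) 𝓘(ℝ, E) (chartAt E x₀).symm v

theorem isInvertible_chart_symm (x₀ : X) {y : E} (hy : y ∈ (chartAt E x₀).target) :
    (mfderiv 𝓘(ℝ, E) 𝓘(ℝ, E) (chartAt E x₀).symm y).IsInvertible :=
  ⟨(mdifferentiable_chart (I := 𝓘(ℝ, E)) x₀).symm.mfderiv hy, rfl⟩

theorem mfderiv_vecRep (x₀ : X) (v : ∀ x : X, TangentSpace 𝓘(ℝ, E) x) {y : E}
    (hy : y ∈ (chartAt E x₀).target) :
    mfderiv 𝓘(ℝ, E) 𝓘(ℝ, E) (chartAt E x₀).symm y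
      (VectorField.mpullback 𝓘(ℝ, E) 𝓘(ℝ, E) (chartAt E x₀).symm v y) =
      v ((chartAt E x₀).symm y) := by
  rw [VectorField.mpullback_apply]
  obtain ⟨L, hL⟩ := isInvertible_chart_symm x₀ hy
  rw [← hL, ContinuousLinearMap.inverse_equiv]
  exact L.apply_symm_apply _

theorem chartRep_interiorAt {k : ℕ} (x₀ : X) (v : ∀ x : X, TangentSpace 𝓘(ℝ, E) x)
    (α : ∀ x : X, AltAt E (k + 1) x) {y : E} (hy : y ∈ (chartAt E x₀).target) :
    chartRep x₀ (interiorAt v α) y = (chartRep x₀ α y).curryLeft (vecRep x₀ v y) := by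
  have h2 := ContinuousAlternatingMap.curryLeft_compContinuousLinearMap
    (show E [⋀^Fin (k + 1)]→L[ℝ] ℝ from α ((chartAt E x₀).symm y))
    (show E →L[ℝ] E from mfderiv 𝓘(ℝ, E) 𝓘(ℝ, E) (chartAt E x₀).symm y) (vecRep x₀ v y)
  refine Eq.trans ?_ h2.symm
  have h3 : (show E →L[ℝ] E from mfderiv 𝓘(ℝ, E) 𝓘(ℝ, E) (chartAt E x₀).symm y) (vecRep x₀ v y) =
      v ((chartAt E x₀).symm y) := mfderiv_vecRep x₀ v hy
  rw [h3]
  rfl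

theorem contDiffAt_vecRep [CompleteSpace E] (x₀ : X) (v : Cₛ^∞⟮𝓘(ℝ, E); E, (TangentSpace 𝓘(ℝ, E) : X → Type _)⟯)
    {y : E} (hy : y ∈ (chartAt E x₀).target) : ContDiffAt ℝ ∞ (vecRep x₀ v) y := by
  refine contMDiffAt_vectorSpace_iff_contDiffAt.1 ?_
  exact ContMDiffAt.mpullback_vectorField_preimage (n := ∞) (v.contMDiff _)
    (contMDiffAt_symm_of_mem_maximalAtlas (IsManifold.chart_mem_maximalAtlas x₀) hy)
    (isInvertible_chart_symm x₀ hy) (by simp)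

theorem IsSmoothOn.interiorAt [CompleteSpace E] {k : ℕ} {U : Set X} (hU : IsOpen U)
    {α : ∀ x : X, AltAt E (k + 1) x} (hα : IsSmoothOn U α)
    (v : Cₛ^∞⟮𝓘(ℝ, E); E, (TangentSpace 𝓘(ℝ, E) : X → Type _)⟯) : IsSmoothOn U (interiorAt v α) := fun x₀ _ hy =>
  ((contDiffAt_curryLeft (hα.contDiffAt hU hy.1 hy.2) (contDiffAt_vecRep x₀ v hy.1)
    ).contDiffWithinAt.congr
    (fun _ hz => chartRep_interiorAt x₀ v α hz.1) (chartRep_interiorAt x₀ v α hy.1))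

end Forms

section Bundled

/-- Smooth vector fields on `X`. -/
abbrev VField (E X : Type*) [NormedAddCommGroup E] [NormedSpace ℝ E] [TopologicalSpace X]
    [ChartedSpace E X] [IsManifold 𝓘(ℝ, E) ∞ X] : Type _ :=
  Cₛ^∞⟮𝓘(ℝ, E); E, (TangentSpace 𝓘(ℝ, E) : X → Type _)⟯

variable {E X : Type*} [NormedAddCommGroup E] [NormedSpace ℝ E] [TopologicalSpace X]
  [ChartedSpace E X]

open Classical in
/-- Extension by zero of a field of alternating forms. -/
def extendZero {k : ℕ} (U : Opens X) (a : ∀ x : U, AltAt E k (x : X)) : ∀ x : X, AltAt E k x :=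
  fun x => if h : x ∈ U then a ⟨x, h⟩ else 0

theorem extendZero_of_mem {k : ℕ} {U : Opens X} (a : ∀ x : U, AltAt E k (x : X)) {x : X}
    (hx : x ∈ U) : extendZero U a x = a ⟨x, hx⟩ := dif_pos hx

theorem extendZero_add {k : ℕ} {U : Opens X} (a b : ∀ x : U, AltAt E k (x : X)) :
    extendZero U (a + b) = extendZero U a + extendZero U b := by
  funext x; by_cases hx : x ∈ U <;> simp [extendZero, hx]

theorem extendZero_smul {k : ℕ} {U : Opens X} (c : ℝ) (a : ∀ x : U, AltAt E k (x : X)) :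
    extendZero U (c • a) = c • extendZero U a := by
  funext x; by_cases hx : x ∈ U <;> simp [extendZero, hx]

variable (E) in
/-- The subspace of smooth fields of alternating `k`-forms on the open set `U`. -/
def smoothForms (U : Opens X) (k : ℕ) : Submodule ℝ (∀ x : U, AltAt E k (x : X)) where
  carrier := {a | IsSmoothOn (U : Set X) (extendZero U a)}
  add_mem' {a b} ha hb x₀ := by
    rw [extendZero_add, chartRep_add]; exact (ha x₀).add (hb x₀)
  zero_mem' x₀ := by
    have h : extendZero U (0 : ∀ x : U, AltAt E k (x : X)) = 0 := by
      funext x; simp [extendZero]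
    rw [h]
    have h2 : chartRep x₀ (0 : ∀ x : X, AltAt E k x) = 0 := rfl
    rw [h2]; exact contDiffOn_const
  smul_mem' c a ha x₀ := by
    rw [extendZero_smul, chartRep_smul]; exact contDiffOn_const.smul (ha x₀)

variable (E) in
/-- The real vector space of smooth differential `k`-forms on the open set `U`. -/
def DForm (U : Opens X) (k : ℕ) : Type _ := smoothForms E U k

instance (U : Opens X) (k : ℕ) : AddCommGroup (DForm E U k) :=
  inferInstanceAs (AddCommGroup (smoothForms E U k))

instance (U : Opens X) (k : ℕ) : Module ℝ (DForm E U k) :=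
  inferInstanceAs (Module ℝ (smoothForms E U k))

namespace DForm

variable {U V W : Opens X} {k : ℕ}

/-- The value of a form at all points of `X`, extended by zero. -/
def toField (a : DForm E U k) : ∀ x : X, AltAt E k x := extendZero U a.1

theorem smooth (a : DForm E U k) : IsSmoothOn (U : Set X) a.toField := a.2

/-- Build a form on `U` from a field of alternating forms that is smooth on `U`. -/
def ofField (α : ∀ x : X, AltAt E k x) (h : IsSmoothOn (U : Set X) α) : DForm E U k :=
  ⟨fun x => α x, h.congr fun _ hx => extendZero_of_mem _ hx⟩

theorem toField_ofField {α : ∀ x : X, AltAt E k x} (h : IsSmoothOn (U : Set X) α) {x : X}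
    (hx : x ∈ U) : (ofField α h : DForm E U k).toField x = α x := extendZero_of_mem _ hx

theorem toField_add (a b : DForm E U k) : (a + b).toField = a.toField + b.toField :=
  extendZero_add _ _

theorem toField_smul (c : ℝ) (a : DForm E U k) : (c • a).toField = c • a.toField :=
  extendZero_smul _ _

theorem ext_field {a b : DForm E U k} (h : ∀ x ∈ U, a.toField x = b.toField x) : a = b := by
  apply Subtype.ext; funext x
  have := h x x.2
  rwa [toField, toField, extendZero_of_mem _ x.2, extendZero_of_mem _ x.2] at this

/-- The local representative of a form in the chart at `x₀`. -/
def rep (x₀ : X) (a : DForm E U k) : E → E [⋀^Fin k]→L[ℝ] ℝ := chartRep x₀ a.toField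

theorem rep_add (x₀ : X) (a b : DForm E U k) : rep x₀ (a + b) = rep x₀ a + rep x₀ b := by
  rw [rep, toField_add]; rfl

theorem rep_smul (x₀ : X) (c : ℝ) (a : DForm E U k) : rep x₀ (c • a) = c • rep x₀ a := by
  rw [rep, toField_smul]; rfl

theorem rep_sub (x₀ : X) (a b : DForm E U k) : rep x₀ (a - b) = rep x₀ a - rep x₀ b := by
  have : a - b = a + (-1 : ℝ) • b := by module
  rw [this, rep_add, rep_smul]; module

theorem rep_zero (x₀ : X) : rep x₀ (0 : DForm E U k) = 0 := by
  have := rep_smul x₀ 0 (0 : DForm E U k)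
  simpa using this

/-- Restriction of forms to a smaller open set. -/
def res (h : V ≤ U) : DForm E U k →ₗ[ℝ] DForm E V k where
  toFun a := ofField a.toField (a.smooth.mono h)
  map_add' a b := by
    apply ext_field; intro x hx
    rw [toField_ofField _ hx, toField_add, toField_add, Pi.add_apply, Pi.add_apply,
      toField_ofField _ hx, toField_ofField _ hx]
  map_smul' c a := by
    apply ext_field; intro x hx
    rw [RingHom.id_apply, toField_ofField _ hx, toField_smul, toField_smul, Pi.smul_apply,
      Pi.smul_apply, toField_ofField _ hx]

/-- Points of a chart domain mapped into `U`, in chart coordinates. -/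
def dom (x₀ : X) (U : Opens X) : Set E :=
  (chartAt E x₀).target ∩ (chartAt E x₀).symm ⁻¹' U

theorem isOpen_dom (x₀ : X) (U : Opens X) : IsOpen (dom (E := E) x₀ U) :=
  isOpen_chart_preimage x₀ U.isOpen

theorem contDiffAt_rep (x₀ : X) (a : DForm E U k) {y : E} (hy : y ∈ dom x₀ U) :
    ContDiffAt ℝ ∞ (rep x₀ a) y := a.smooth.contDiffAt U.isOpen hy.1 hy.2

theorem rep_res (h : V ≤ U) (x₀ : X) (a : DForm E U k) {y : E} (hy : y ∈ dom x₀ V) :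
    rep x₀ (res h a) y = rep x₀ a y := chartRep_congr (toField_ofField (a.smooth.mono h) hy.2)

variable [IsManifold 𝓘(ℝ, E) ∞ X]

theorem ext_rep {a b : DForm E U k} (h : ∀ x₀ : X, ∀ y ∈ dom x₀ U, rep x₀ a y = rep x₀ b y) :
    a = b := by
  apply ext_field
  intro x hx
  refine eq_of_chartRep_eq (h x _ ⟨mem_chart_target E x, ?_⟩)
  simpa using hx

theorem rep_ofField_extDerivAt (a : DForm E U k) (x₀ : X) {y : E} (hy : y ∈ dom x₀ U) :
    rep x₀ (ofField (U := U) _ (a.smooth.extDerivAt U.isOpen)) y = extDeriv (rep x₀ a) y :=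
  (chartRep_congr (toField_ofField _ hy.2)).trans
    (chartRep_extDerivAt U.isOpen a.smooth hy.1 hy.2)

/-- The exterior derivative. -/
def d : DForm E U k →ₗ[ℝ] DForm E U (k + 1) where
  toFun a := ofField (extDerivAt a.toField) (a.smooth.extDerivAt U.isOpen)
  map_add' a b := by
    apply ext_rep; intro x₀ y hy
    rw [rep_add, Pi.add_apply, rep_ofField_extDerivAt _ _ hy, rep_ofField_extDerivAt _ _ hy,
      rep_ofField_extDerivAt _ _ hy, rep_add]
    exact extDeriv_add ((contDiffAt_rep x₀ a hy).differentiableAt (by simp))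
      ((contDiffAt_rep x₀ b hy).differentiableAt (by simp))
  map_smul' c a := by
    apply ext_rep; intro x₀ y hy
    rw [RingHom.id_apply, rep_smul, Pi.smul_apply, rep_ofField_extDerivAt _ _ hy,
      rep_ofField_extDerivAt _ _ hy, rep_smul]
    exact extDeriv_smul _ _

theorem rep_d (a : DForm E U k) (x₀ : X) {y : E} (hy : y ∈ dom x₀ U) :
    rep x₀ (d a) y = extDeriv (rep x₀ a) y := rep_ofField_extDerivAt a x₀ hy

theorem rep_eventuallyEq {a : DForm E U k} {x₀ : X} {y : E} (hy : y ∈ dom x₀ U)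
    {f : E → E [⋀^Fin k]→L[ℝ] ℝ} (h : ∀ z ∈ dom x₀ U, rep x₀ a z = f z) :
    rep x₀ a =ᶠ[𝓝 y] f := by
  filter_upwards [(isOpen_dom x₀ U).mem_nhds hy] with z hz using h z hz

theorem d_d (a : DForm E U k) : d (d a) = 0 := by
  apply ext_rep; intro x₀ y hy
  rw [rep_d _ _ hy, (rep_eventuallyEq hy fun z hz => rep_d a x₀ hz).extDeriv_eq, rep_zero]
  exact extDeriv_extDeriv_apply (contDiffAt_rep x₀ a hy)
    (by simp only [minSmoothness_of_isRCLikeNormedField]; exact ENat.LEInfty.out)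

theorem d_res (h : V ≤ U) (a : DForm E U k) : d (res h a) = res h (d a) := by
  apply ext_rep; intro x₀ y hy
  have hy' : y ∈ dom x₀ U := ⟨hy.1, h hy.2⟩
  rw [rep_d _ _ hy, rep_res h _ _ hy, rep_d _ _ hy',
    (rep_eventuallyEq hy fun z hz => rep_res h x₀ a hz).extDeriv_eq]

theorem res_res (h : V ≤ U) (h' : W ≤ V) (a : DForm E U k) :
    res h' (res h a) = res (h'.trans h) a := by
  apply ext_rep; intro x₀ y hy
  rw [rep_res _ _ _ hy, rep_res _ _ _ hy, rep_res _ _ _ ⟨hy.1, h' hy.2⟩]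

variable [FiniteDimensional ℝ E]

theorem interior_smooth (v : VField E X) (a : DForm E U (k + 1)) :
    IsSmoothOn (U : Set X) (interiorAt v a.toField) :=
  have := FiniteDimensional.complete ℝ E
  a.smooth.interiorAt U.isOpen v

theorem rep_ofField_interiorAt (v : VField E X) (a : DForm E U (k + 1)) (x₀ : X) {y : E}
    (hy : y ∈ dom x₀ U) : rep x₀ (ofField (U := U) _ (interior_smooth v a)) y =
      (rep x₀ a y).curryLeft (vecRep x₀ v y) :=
  (chartRep_congr (toField_ofField _ hy.2)).trans (chartRep_interiorAt x₀ v _ hy.1)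

/-- The interior product `ι_v a`. -/
def interior : VField E X →ₗ[ℝ] DForm E U (k + 1) →ₗ[ℝ] DForm E U k :=
  LinearMap.mk₂ ℝ (fun v a => ofField (interiorAt v a.toField) (interior_smooth v a))
    (fun v w a => by
      apply ext_rep; intro x₀ y hy
      rw [rep_add, Pi.add_apply, rep_ofField_interiorAt _ _ _ hy, rep_ofField_interiorAt _ _ _ hy,
        rep_ofField_interiorAt _ _ _ hy]
      have : vecRep x₀ (v + w : VField E X) y = vecRep x₀ v y + vecRep x₀ w y :=
        map_add (ContinuousLinearMap.inverse
          (mfderiv 𝓘(ℝ, E) 𝓘(ℝ, E) (chartAt E x₀).symm y)) _ _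
      rw [this, map_add])
    (fun c v a => by
      apply ext_rep; intro x₀ y hy
      rw [rep_smul, Pi.smul_apply, rep_ofField_interiorAt _ _ _ hy,
        rep_ofField_interiorAt _ _ _ hy]
      have : vecRep x₀ (c • v : VField E X) y = c • vecRep x₀ v y :=
        map_smul (ContinuousLinearMap.inverse
          (mfderiv 𝓘(ℝ, E) 𝓘(ℝ, E) (chartAt E x₀).symm y)) _ _
      rw [this, map_smul])
    (fun v a b => by
      apply ext_rep; intro x₀ y hy
      rw [rep_add, Pi.add_apply, rep_ofField_interiorAt _ _ _ hy, rep_ofField_interiorAt _ _ _ hy,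
        rep_ofField_interiorAt _ _ _ hy, rep_add]
      rfl)
    (fun c v a => by
      apply ext_rep; intro x₀ y hy
      rw [rep_smul, Pi.smul_apply, rep_ofField_interiorAt _ _ _ hy,
        rep_ofField_interiorAt _ _ _ hy, rep_smul]
      rfl)

theorem rep_interior (v : VField E X) (a : DForm E U (k + 1)) (x₀ : X) {y : E}
    (hy : y ∈ dom x₀ U) : rep x₀ (interior v a) y =
      (rep x₀ a y).curryLeft (vecRep x₀ v y) := rep_ofField_interiorAt v a x₀ hy

theorem interior_anticomm (u v : VField E X) (a : DForm E U (k + 2)) :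
    interior u (interior v a) = - interior v (interior u a) := by
  have : interior u (interior v a) + interior v (interior u a) = 0 := by
    apply ext_rep; intro x₀ y hy
    rw [rep_add, Pi.add_apply, rep_interior _ _ _ hy, rep_interior _ _ _ hy,
      rep_interior _ _ _ hy, rep_interior _ _ _ hy, rep_zero]
    ext w
    have h := (rep x₀ a y).map_swap
      (Matrix.vecCons (vecRep x₀ v y) (Matrix.vecCons (vecRep x₀ u y) w))
      (i := 0) (j := 1) (by simp)
    have h2 : Matrix.vecCons (vecRep x₀ v y) (Matrix.vecCons (vecRep x₀ u y) w) ∘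
        Equiv.swap (0 : Fin (k + 2)) 1 =
        Matrix.vecCons (vecRep x₀ u y) (Matrix.vecCons (vecRep x₀ v y) w) := by
      funext i
      refine Fin.cases ?_ (fun i => Fin.cases ?_ (fun i => ?_) i) i
      · simp
      · simp
      · rw [Function.comp_apply, Equiv.swap_apply_of_ne_of_ne] <;> simp [Fin.ext_iff]
    rw [h2] at h
    have h' : rep x₀ a y (Matrix.vecCons (vecRep x₀ u y) (Matrix.vecCons (vecRep x₀ v y) w)) =
      -rep x₀ a y (Matrix.vecCons (vecRep x₀ v y) (Matrix.vecCons (vecRep x₀ u y) w)) := h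
    simp [h']
  exact eq_neg_of_add_eq_zero_left this

theorem interior_res (h : V ≤ U) (v : VField E X) (a : DForm E U (k + 1)) :
    interior v (res h a) = res h (interior v a) := by
  apply ext_rep; intro x₀ y hy
  rw [rep_interior _ _ _ hy, rep_res _ _ _ hy, rep_res _ _ _ hy,
    rep_interior _ _ _ ⟨hy.1, h hy.2⟩]

/-- The Lie derivative `L_v = d ι_v + ι_v d`. -/
def lie : {k : ℕ} → VField E X →ₗ[ℝ] DForm E U k →ₗ[ℝ] DForm E U k
  | 0 => interior.compl₂ d
  | _ + 1 => interior.compr₂ d + interior.compl₂ d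

theorem lie_zero (v : VField E X) (a : DForm E U 0) : lie v a = interior v (d a) := rfl

theorem lie_succ (v : VField E X) (a : DForm E U (k + 1)) :
    lie v a = d (interior v a) + interior v (d a) := rfl

theorem lie_d (v : VField E X) (a : DForm E U k) : lie v (d a) = d (lie v a) := by
  cases k with
  | zero => rw [lie_succ, lie_zero, d_d, map_zero, add_zero]
  | succ k => rw [lie_succ, lie_succ, d_d, map_zero, add_zero, map_add, d_d, zero_add]

theorem lie_res (h : V ≤ U) (v : VField E X) (a : DForm E U k) :
    lie v (res h a) = res h (lie v a) := by
  cases k with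
  | zero => rw [lie_zero, lie_zero, d_res, interior_res]
  | succ k => rw [lie_succ, lie_succ, d_res, interior_res, interior_res, d_res, map_add]

theorem rep_lie (v : VField E X) (a : DForm E U k) (x₀ : X) {y : E} (hy : y ∈ dom x₀ U)
    (w : Fin k → E) : rep x₀ (lie v a) y w = lieModel (vecRep x₀ v) (rep x₀ a) y w := by
  have := FiniteDimensional.complete ℝ E
  cases k with
  | zero => rw [lie_zero, rep_interior _ _ _ hy, rep_d _ _ hy, lieModel_zero]
  | succ k =>
    rw [lie_succ, rep_add, Pi.add_apply, rep_d _ _ hy, rep_interior _ _ _ hy, rep_d _ _ hy,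
      (rep_eventuallyEq hy fun z hz => rep_interior v a x₀ hz).extDeriv_eq,
      ContinuousAlternatingMap.add_apply]
    exact lieModel_succ ((contDiffAt_rep x₀ a hy).differentiableAt (by simp))
      ((contDiffAt_vecRep x₀ v hy.1).differentiableAt (by simp)) w

end DForm

variable [IsManifold 𝓘(ℝ, E) ∞ X] [FiniteDimensional ℝ E]

theorem contMDiff_mlieBracket (u v : VField E X) :
    ContMDiff 𝓘(ℝ, E) (𝓘(ℝ, E).prod 𝓘(ℝ, E)) ∞
      (fun x => (⟨x, VectorField.mlieBracket 𝓘(ℝ, E) u v x⟩ : TangentBundle 𝓘(ℝ, E) X)) := by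
  have := FiniteDimensional.complete ℝ E
  have : IsManifold 𝓘(ℝ, E) (((⊤ : ℕ∞) : WithTop ℕ∞) + 1) X := by
    have : ((⊤ : ℕ∞) : WithTop ℕ∞) + 1 = ∞ := rfl
    rw [this]; infer_instance
  have : IsManifold 𝓘(ℝ, E) (minSmoothness ℝ 2) X := by
    rw [minSmoothness_of_isRCLikeNormedField]
    exact .of_le (n := ∞) ENat.LEInfty.out
  have : IsManifold 𝓘(ℝ, E) (minSmoothness ℝ 3) X := by
    rw [minSmoothness_of_isRCLikeNormedField]
    exact .of_le (n := ∞) ENat.LEInfty.out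
  intro x
  exact ContMDiffAt.mlieBracket_vectorField (m := ⊤) (n := ⊤) (u.contMDiff x) (v.contMDiff x)
    (by simp only [minSmoothness_of_isRCLikeNormedField]; rfl)

/-- The Lie bracket of smooth vector fields. -/
def vbracket (u v : VField E X) : VField E X :=
  ⟨VectorField.mlieBracket 𝓘(ℝ, E) u v, contMDiff_mlieBracket u v⟩

theorem vecRep_vbracket (u v : VField E X) (x₀ : X) {y : E} (hy : y ∈ (chartAt E x₀).target) :
    vecRep x₀ (vbracket u v) y = VectorField.lieBracket ℝ (vecRep x₀ u) (vecRep x₀ v) y := by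
  have := FiniteDimensional.complete ℝ E
  have hM : IsManifold 𝓘(ℝ, E) (minSmoothness ℝ 2) X := by
    rw [minSmoothness_of_isRCLikeNormedField]
    exact .of_le (n := ∞) ENat.LEInfty.out
  have h := VectorField.mpullback_mlieBracket (n := ∞) (f := (chartAt E x₀).symm) (x₀ := y)
    ((u.contMDiff _).mdifferentiableAt (by simp)) ((v.contMDiff _).mdifferentiableAt (by simp))
    (contMDiffAt_symm_of_mem_maximalAtlas (IsManifold.chart_mem_maximalAtlas x₀) hy)
    (by simp only [minSmoothness_of_isRCLikeNormedField]; exact ENat.LEInfty.out)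
  refine h.trans ?_
  rw [← VectorField.mlieBracketWithin_univ, VectorField.mlieBracketWithin_eq_lieBracketWithin]
  exact congrFun (VectorField.lieBracketWithin_univ (V := vecRep x₀ u) (W := vecRep x₀ v)) y

namespace DForm
variable {U : Opens X} {k : ℕ}

theorem interior_vbracket (u v : VField E X) (a : DForm E U (k + 1)) :
    interior (vbracket u v) a = lie u (interior v a) - interior v (lie u a) := by
  have := FiniteDimensional.complete ℝ E
  apply ext_rep; intro x₀ y hy
  rw [rep_sub, Pi.sub_apply, rep_interior _ _ _ hy, rep_interior _ _ _ hy,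
    vecRep_vbracket _ _ _ hy.1]
  ext w
  rw [ContinuousAlternatingMap.sub_apply, rep_lie _ _ _ hy,
    ContinuousAlternatingMap.curryLeft_apply_apply (rep x₀ (lie u a) y), rep_lie _ _ _ hy,
    cartan_model ((contDiffAt_rep x₀ a hy).differentiableAt (by simp))
      ((contDiffAt_vecRep x₀ v hy.1).differentiableAt (by simp))]
  have := rep_eventuallyEq hy fun z hz => rep_interior v a x₀ hz
  simp only [lieModel, this.fderiv_eq, this.eq_of_nhds]

theorem lie_vbracket (u v : VField E X) (a : DForm E U k) :
    lie (vbracket u v) a = lie u (lie v a) - lie v (lie u a) := by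
  cases k with
  | zero => rw [lie_zero, interior_vbracket, lie_d, ← lie_zero, lie_zero v (lie u a)]
  | succ k =>
    rw [lie_succ, interior_vbracket, interior_vbracket, lie_d, map_sub, ← lie_d,
      lie_succ v a, lie_succ v (lie u a), map_add]
    abel

end DForm
end Bundled

section LogDerivative

variable {E X : Type*} [NormedAddCommGroup E] [NormedSpace ℝ E] [TopologicalSpace X]
  [ChartedSpace E X]

/-- The real 1-form `(2πi)⁻¹ g⁻¹ dg` at `x`, for a function `g` with values of modulus one,
so that `g⁻¹` is the complex conjugate of `g`. -/
def dlogAt (g : X → ℂ) (x : X) : AltAt E 1 x :=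
  ContinuousAlternatingMap.ofSubsingleton ℝ (TangentSpace 𝓘(ℝ, E) x) ℝ (0 : Fin 1)
    ((2 * Real.pi)⁻¹ • Complex.imCLM.comp
      ((starRingEnd ℂ (g x)) •
        (show TangentSpace 𝓘(ℝ, E) x →L[ℝ] ℂ from mfderiv 𝓘(ℝ, E) 𝓘(ℝ, ℂ) g x)))

open Classical in
/-- A circle-valued function on `U` as a complex function on `X`, extended by `1`. -/
def circleExtend {U : Opens X} (g : U → Circle) : X → ℂ :=
  fun x => if h : x ∈ U then (g ⟨x, h⟩ : ℂ) else 1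

theorem contDiffAt_dlog {F : E → ℂ} {y : E} (hF : ContDiffAt ℝ ∞ F y) :
    ContDiffAt ℝ ∞ (fun z => ContinuousAlternatingMap.ofSubsingleton ℝ E ℝ (0 : Fin 1)
      ((2 * Real.pi)⁻¹ • Complex.imCLM.comp ((starRingEnd ℂ (F z)) • fderiv ℝ F z))) y := by
  have h1 : ContDiffAt ℝ ∞ (fderiv ℝ F) y := hF.fderiv_right (by simp)
  have h2 : ContDiffAt ℝ ∞ (fun z => starRingEnd ℂ (F z)) y :=
    (Complex.conjCLE : ℂ →L[ℝ] ℂ).contDiff.contDiffAt.comp y hF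
  have h3 : ContDiffAt ℝ ∞ (fun z => (2 * Real.pi)⁻¹ •
      Complex.imCLM.comp ((starRingEnd ℂ (F z)) • fderiv ℝ F z)) y :=
    (contDiffAt_const.clm_comp (h2.smul h1)).const_smul _
  exact ((ContinuousAlternatingMap.ofSubsingletonLIE (𝕜 := ℝ) (E := E) (F := ℝ)
    (0 : Fin 1)).toContinuousLinearEquiv.contDiff.contDiffAt).comp y h3

variable [IsManifold 𝓘(ℝ, E) ∞ X]

theorem contMDiffAt_circleExtend {U : Opens X} (g : C^∞⟮𝓘(ℝ, E), U; 𝓡 1, Circle⟯) {x : X}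
    (hx : x ∈ U) : ContMDiffAt 𝓘(ℝ, E) 𝓘(ℝ, ℂ) ∞ (circleExtend g) x := by
  have h1 : ContMDiff 𝓘(ℝ, E) 𝓘(ℝ, ℂ) ∞ (fun z : U => (g z : ℂ)) := by
    have h2 : ContMDiff (𝓡 1) 𝓘(ℝ, ℂ) ∞ (fun z : Circle => (z : ℂ)) :=
      have : Fact (Module.finrank ℝ ℂ = 1 + 1) := finrank_real_complex_fact'
      contMDiff_coe_sphere (E := ℂ) (n := 1)
    exact h2.comp g.contMDiff
  have h3 : (fun z : U => circleExtend g (z : X)) = fun z : U => (g z : ℂ) := by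
    funext z; exact dif_pos z.2
  have h4 := h1 ⟨x, hx⟩
  rw [← h3] at h4
  exact contMDiffAt_subtype_iff.1 h4

theorem isSmoothOn_dlogAt {U : Opens X} (g : C^∞⟮𝓘(ℝ, E), U; 𝓡 1, Circle⟯) :
    IsSmoothOn (E := E) (U : Set X) (dlogAt (circleExtend g)) := by
  intro x₀ y hy
  have hs : ∀ z ∈ DForm.dom x₀ U, ContMDiffAt 𝓘(ℝ, E) 𝓘(ℝ, E) ∞ (chartAt E x₀).symm z :=
    fun z hz => contMDiffAt_symm_of_mem_maximalAtlas (IsManifold.chart_mem_maximalAtlas x₀) hz.1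
  have key : ∀ z ∈ DForm.dom x₀ U, chartRep x₀ (dlogAt (circleExtend g)) z =
      ContinuousAlternatingMap.ofSubsingleton ℝ E ℝ (0 : Fin 1)
        ((2 * Real.pi)⁻¹ • Complex.imCLM.comp
          ((starRingEnd ℂ ((circleExtend g ∘ (chartAt E x₀).symm) z)) •
            fderiv ℝ (circleExtend g ∘ (chartAt E x₀).symm) z)) := by
    intro z hz
    have hc : fderiv ℝ (circleExtend g ∘ (chartAt E x₀).symm) z =
        (mfderiv 𝓘(ℝ, E) 𝓘(ℝ, ℂ) (circleExtend g) ((chartAt E x₀).symm z)).comp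
          (mfderiv 𝓘(ℝ, E) 𝓘(ℝ, E) (chartAt E x₀).symm z) := by
      rw [← mfderiv_eq_fderiv]
      exact mfderiv_comp (I' := 𝓘(ℝ, E)) z
        ((contMDiffAt_circleExtend g hz.2).mdifferentiableAt (by simp))
        ((hs z hz).mdifferentiableAt (by simp))
    rw [hc]
    rfl
  have hF : ContDiffAt ℝ ∞ (circleExtend g ∘ (chartAt E x₀).symm) y :=
    contMDiffAt_iff_contDiffAt.1 ((contMDiffAt_circleExtend g hy.2).comp y (hs y hy))
  exact (contDiffAt_dlog hF).contDiffWithinAt.congr (fun z hz => key z hz) (key y hy)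

/-- The 1-form `dlog g = (2πi)⁻¹ g⁻¹ dg` of a smooth circle-valued function. -/
def dlog {U : Opens X} (g : C^∞⟮𝓘(ℝ, E), U; 𝓡 1, Circle⟯) : DForm E U 1 :=
  DForm.ofField (dlogAt (circleExtend g)) (isSmoothOn_dlogAt g)

end LogDerivative

section Cech

variable {E X : Type*} [NormedAddCommGroup E] [NormedSpace ℝ E] [TopologicalSpace X]
  [ChartedSpace E X]

variable (E) in
/-- Families of `k`-forms on a family of open sets. -/
abbrev FormFamily {κ : Type*} (V : κ → Opens X) (k : ℕ) : Type _ := ∀ a, DForm E (V a) k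

variable {κ : Type*} {V : κ → Opens X} {k : ℕ}

variable (V) in
/-- Restriction of a global form to all members of a family of open sets. -/
def famRes : DForm E (⊤ : Opens X) k →ₗ[ℝ] FormFamily E V k :=
  LinearMap.pi fun _ => DForm.res le_top

variable [IsManifold 𝓘(ℝ, E) ∞ X]

/-- The exterior derivative, memberwise. -/
def famD : FormFamily E V k →ₗ[ℝ] FormFamily E V (k + 1) :=
  LinearMap.pi fun a => DForm.d ∘ₗ LinearMap.proj a

theorem famD_famD (a : FormFamily E V k) : famD (famD a) = 0 := funext fun _ => DForm.d_d _

variable [FiniteDimensional ℝ E]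

/-- The interior product, memberwise. -/
def famInterior : VField E X →ₗ[ℝ] FormFamily E V (k + 1) →ₗ[ℝ] FormFamily E V k :=
  LinearMap.mk₂ ℝ (fun v θ a => DForm.interior v (θ a))
    (fun _ _ _ => by ext1; simp) (fun _ _ _ => by ext1; simp)
    (fun _ _ _ => by ext1; simp) (fun _ _ _ => by ext1; simp)

/-- The Lie derivative, memberwise. -/
def famLie : VField E X →ₗ[ℝ] FormFamily E V k →ₗ[ℝ] FormFamily E V k :=
  LinearMap.mk₂ ℝ (fun v θ a => DForm.lie v (θ a))
    (fun _ _ _ => by ext1; simp) (fun _ _ _ => by ext1; simp)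
    (fun _ _ _ => by ext1; simp) (fun _ _ _ => by ext1; simp)

theorem famLie_zero (v : VField E X) (a : FormFamily E V 0) :
    famLie v a = famInterior v (famD a) := rfl

theorem famLie_succ (v : VField E X) (a : FormFamily E V (k + 1)) :
    famLie v a = famD (famInterior v a) + famInterior v (famD a) := rfl

theorem famLie_famD (v : VField E X) (a : FormFamily E V k) :
    famLie v (famD a) = famD (famLie v a) := funext fun _ => DForm.lie_d _ _

theorem famLie_vbracket (u v : VField E X) (a : FormFamily E V k) :
    famLie (vbracket u v) a = famLie u (famLie v a) - famLie v (famLie u a) :=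
  funext fun _ => DForm.lie_vbracket _ _ _

theorem famInterior_vbracket (u v : VField E X) (a : FormFamily E V (k + 1)) :
    famInterior (vbracket u v) a = famLie u (famInterior v a) - famInterior v (famLie u a) :=
  funext fun _ => DForm.interior_vbracket _ _ _

theorem famD_famRes (a : DForm E (⊤ : Opens X) k) : famD (famRes V a) = famRes V (DForm.d a) :=
  funext fun _ => DForm.d_res le_top _

theorem famInterior_famRes (v : VField E X) (a : DForm E (⊤ : Opens X) (k + 1)) :
    famInterior v (famRes V a) = famRes V (DForm.interior v a) :=
  funext fun _ => DForm.interior_res le_top _ _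

variable {ι : Type*} (𝒰 : ι → Opens X)

/-- The twofold intersections of an open cover. -/
def inter2 (p : ι × ι) : Opens X := 𝒰 p.1 ⊓ 𝒰 p.2

/-- The threefold intersections of an open cover. -/
def inter3 (p : ι × ι × ι) : Opens X := 𝒰 p.1 ⊓ 𝒰 p.2.1 ⊓ 𝒰 p.2.2

variable {𝒰}

theorem inter2_le_left (i j : ι) : inter2 𝒰 (i, j) ≤ 𝒰 i := inf_le_left

theorem inter2_le_right (i j : ι) : inter2 𝒰 (i, j) ≤ 𝒰 j := inf_le_right

theorem inter3_le_left (i j l : ι) : inter3 𝒰 (i, j, l) ≤ inter2 𝒰 (i, j) := inf_le_left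

theorem inter3_le_right (i j l : ι) : inter3 𝒰 (i, j, l) ≤ inter2 𝒰 (j, l) :=
  le_inf (inf_le_left.trans inf_le_right) inf_le_right

theorem inter3_le_outer (i j l : ι) : inter3 𝒰 (i, j, l) ≤ inter2 𝒰 (i, l) :=
  le_inf (inf_le_left.trans inf_le_left) inf_le_right

/-- The Čech differential `(δ θ)_{ij} = θ_j - θ_i`. -/
def cech0 : FormFamily E 𝒰 k →ₗ[ℝ] FormFamily E (inter2 𝒰) k :=
  LinearMap.pi fun (i, j) =>
    DForm.res (inter2_le_right i j) ∘ₗ LinearMap.proj j -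
      DForm.res (inter2_le_left i j) ∘ₗ LinearMap.proj i

/-- The Čech differential `(δ θ)_{ijl} = θ_{jl} - θ_{il} + θ_{ij}`. -/
def cech1 : FormFamily E (inter2 𝒰) k →ₗ[ℝ] FormFamily E (inter3 𝒰) k :=
  LinearMap.pi fun (i, j, l) =>
    DForm.res (inter3_le_right i j l) ∘ₗ LinearMap.proj (j, l) -
      DForm.res (inter3_le_outer i j l) ∘ₗ LinearMap.proj (i, l) +
      DForm.res (inter3_le_left i j l) ∘ₗ LinearMap.proj (i, j)

theorem cech1_cech0 (a : FormFamily E 𝒰 k) : cech1 (cech0 a) = 0 := by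
  funext p
  simp only [cech1, cech0, LinearMap.pi_apply, LinearMap.add_apply, LinearMap.sub_apply,
    LinearMap.comp_apply, LinearMap.proj_apply, map_sub, DForm.res_res, Pi.zero_apply]
  abel

theorem cech0_famRes (a : DForm E (⊤ : Opens X) k) : cech0 (famRes 𝒰 a) = 0 := by
  funext p
  simp only [cech0, famRes, LinearMap.pi_apply, LinearMap.sub_apply,
    LinearMap.comp_apply, LinearMap.proj_apply, DForm.res_res, Pi.zero_apply, sub_self]

theorem famD_cech0 (a : FormFamily E 𝒰 k) : famD (cech0 a) = cech0 (famD a) := by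
  funext p
  simp only [cech0, famD, LinearMap.pi_apply, LinearMap.sub_apply,
    LinearMap.comp_apply, LinearMap.proj_apply, map_sub, DForm.d_res]

theorem famD_cech1 (a : FormFamily E (inter2 𝒰) k) : famD (cech1 a) = cech1 (famD a) := by
  funext p
  simp only [cech1, famD, LinearMap.pi_apply, LinearMap.sub_apply, LinearMap.add_apply,
    LinearMap.comp_apply, LinearMap.proj_apply, map_sub, map_add, DForm.d_res]

theorem famInterior_apply (v : VField E X) (a : FormFamily E V (k + 1)) (i : κ) :
    famInterior v a i = DForm.interior v (a i) := rfl

theorem famLie_apply (v : VField E X) (a : FormFamily E V k) (i : κ) :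
    famLie v a i = DForm.lie v (a i) := rfl

theorem famInterior_cech0 (v : VField E X) (a : FormFamily E 𝒰 (k + 1)) :
    famInterior v (cech0 a) = cech0 (famInterior v a) := by
  funext p
  simp only [cech0, famInterior_apply, LinearMap.pi_apply, LinearMap.sub_apply,
    LinearMap.comp_apply, LinearMap.proj_apply, map_sub, DForm.interior_res]

theorem famInterior_cech1 (v : VField E X) (a : FormFamily E (inter2 𝒰) (k + 1)) :
    famInterior v (cech1 a) = cech1 (famInterior v a) := by
  funext p
  simp only [cech1, famInterior_apply, LinearMap.pi_apply, LinearMap.sub_apply,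
    LinearMap.add_apply, LinearMap.comp_apply, LinearMap.proj_apply, map_sub, map_add,
    DForm.interior_res]

theorem famLie_cech0 (v : VField E X) (a : FormFamily E 𝒰 k) :
    famLie v (cech0 a) = cech0 (famLie v a) := by
  funext p
  simp only [cech0, famLie_apply, LinearMap.pi_apply, LinearMap.sub_apply,
    LinearMap.comp_apply, LinearMap.proj_apply, map_sub, DForm.lie_res]

theorem famLie_cech1 (v : VField E X) (a : FormFamily E (inter2 𝒰) k) :
    famLie v (cech1 a) = cech1 (famLie v a) := by
  funext p
  simp only [cech1, famLie_apply, LinearMap.pi_apply, LinearMap.sub_apply,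
    LinearMap.add_apply, LinearMap.comp_apply, LinearMap.proj_apply, map_sub, map_add,
    DForm.lie_res]

variable (E 𝒰) in
/-- A Čech–Deligne 2-cocycle with respect to the open cover `𝒰`: 2-forms `A2` on the members,
1-forms `A1` on the twofold intersections and circle-valued functions `A0` on the threefold
intersections, with `δ A2 = d A1`, `δ A1 = - dlog A0` and `δ A0 = 1`. -/
structure DeligneCocycle where
  A2 : FormFamily E 𝒰 2
  A1 : FormFamily E (inter2 𝒰) 1
  A0 : ∀ p : ι × ι × ι, C^∞⟮𝓘(ℝ, E), inter3 𝒰 p; 𝓡 1, Circle⟯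
  cocycle2 : cech0 A2 = famD A1
  cocycle1 : cech1 A1 = -fun p => dlog (A0 p)
  cocycle0 : ∀ (i j l m : ι) (x : X) (hi : x ∈ 𝒰 i) (hj : x ∈ 𝒰 j) (hl : x ∈ 𝒰 l)
    (hm : x ∈ 𝒰 m),
    A0 (j, l, m) ⟨x, ⟨hj, hl⟩, hm⟩ * (A0 (i, l, m) ⟨x, ⟨hi, hl⟩, hm⟩)⁻¹ *
      A0 (i, j, m) ⟨x, ⟨hi, hj⟩, hm⟩ * (A0 (i, j, l) ⟨x, ⟨hi, hj⟩, hl⟩)⁻¹ = 1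

namespace DeligneCocycle

variable (A : DeligneCocycle E 𝒰)

/-- The family of 1-forms `dlog A0` on the threefold intersections. -/
def dlogA0 : FormFamily E (inter3 𝒰) 1 := fun p => dlog (A.A0 p)

theorem dlogA0_eq : A.dlogA0 = -cech1 A.A1 := by
  rw [A.cocycle1, neg_neg]; rfl

theorem famD_dlogA0 : famD A.dlogA0 = 0 := by
  rw [dlogA0_eq, map_neg, famD_cech1, ← A.cocycle2, cech1_cech0, neg_zero]

/-- The 2-cocycle `A` prequantizes the 3-form `om`: the curvature form of `A` is `om`. -/
def Prequantizes (om : DForm E (⊤ : Opens X) 3) : Prop := famD A.A2 = famRes 𝒰 om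

/-- The Lie derivative of the cocycle along `v`, in degree two of the Čech–de Rham total complex;
its last component is `L_v A0 = ι_v (dlog A0)`. -/
def lieTot : VField E X →ₗ[ℝ]
    FormFamily E 𝒰 2 × FormFamily E (inter2 𝒰) 1 × FormFamily E (inter3 𝒰) 0 :=
  (famLie.flip A.A2).prod ((famLie.flip A.A1).prod (famInterior.flip A.dlogA0))

end DeligneCocycle

/-- The total differential of a 0-cochain of functions. -/
def dTot0 : FormFamily E 𝒰 0 →ₗ[ℝ] FormFamily E 𝒰 1 × FormFamily E (inter2 𝒰) 0 :=
  famD.prod cech0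

/-- The total differential `(θ¹, θ⁰) ↦ (d θ¹, δ θ¹ - d θ⁰, δ θ⁰)` in total degree one. -/
def dTot1 : FormFamily E 𝒰 1 × FormFamily E (inter2 𝒰) 0 →ₗ[ℝ]
    FormFamily E 𝒰 2 × FormFamily E (inter2 𝒰) 1 × FormFamily E (inter3 𝒰) 0 :=
  (famD ∘ₗ LinearMap.fst ℝ _ _).prod
    ((cech0 ∘ₗ LinearMap.fst ℝ _ _ - famD ∘ₗ LinearMap.snd ℝ _ _).prod
      (cech1 ∘ₗ LinearMap.snd ℝ _ _))

theorem dTot1_dTot0 (η : FormFamily E 𝒰 0) : dTot1 (dTot0 η) = 0 :=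
  Prod.ext (famD_famD η) (Prod.ext (sub_eq_zero.2 (famD_cech0 η).symm) (cech1_cech0 η))

end Cech

section TwoTerm

/-- The data of an L∞-structure on a two-term complex `d : V₁ → V₀`: the bracket `l2` of two
elements of degree 0, the bracket `act` of an element of degree 0 and an element of degree 1, and
the ternary bracket `l3` of elements of degree 0. All other components vanish for degree reasons. -/
structure TwoTerm (V₀ V₁ : Type*) [AddCommGroup V₀] [Module ℝ V₀] [AddCommGroup V₁]
    [Module ℝ V₁] where
  d : V₁ →ₗ[ℝ] V₀
  l2 : V₀ → V₀ → V₀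
  act : V₀ → V₁ → V₁
  l3 : V₀ → V₀ → V₀ → V₁

variable {V₀ V₁ W₀ W₁ Z₀ Z₁ : Type*} [AddCommGroup V₀] [Module ℝ V₀] [AddCommGroup V₁]
  [Module ℝ V₁] [AddCommGroup W₀] [Module ℝ W₀] [AddCommGroup W₁] [Module ℝ W₁]

/-- The laws of a Lie 2-algebra, i.e. of an L∞-algebra concentrated in degrees 0 and 1: the brackets
are multilinear and graded skew-symmetric and satisfy the higher Jacobi identities. -/
structure TwoTerm.IsLie2Algebra (L : TwoTerm V₀ V₁) : Prop where
  l2_linear : ∀ y, IsLinearMap ℝ fun x => L.l2 x y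
  act_linear_left : ∀ h, IsLinearMap ℝ fun x => L.act x h
  act_linear_right : ∀ x, IsLinearMap ℝ (L.act x)
  l3_linear : ∀ y z, IsLinearMap ℝ fun x => L.l3 x y z
  l2_skew : ∀ x y, L.l2 x y = -L.l2 y x
  l3_skew_left : ∀ x y z, L.l3 x y z = -L.l3 y x z
  l3_skew_right : ∀ x y z, L.l3 x y z = -L.l3 x z y
  d_act : ∀ x h, L.d (L.act x h) = L.l2 x (L.d h)
  act_d : ∀ h k, L.act (L.d h) k = -L.act (L.d k) h
  jacobi : ∀ x y z, L.d (L.l3 x y z) + L.l2 (L.l2 x y) z + L.l2 (L.l2 y z) x +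
    L.l2 (L.l2 z x) y = 0
  jacobi_act : ∀ x y h, L.l3 (L.d h) x y =
    -L.act (L.l2 x y) h + L.act x (L.act y h) - L.act y (L.act x h)
  jacobi_l3 : ∀ x y z w,
    L.act x (L.l3 y z w) - L.act y (L.l3 x z w) + L.act z (L.l3 x y w) - L.act w (L.l3 x y z) =
      L.l3 (L.l2 x y) z w - L.l3 (L.l2 x z) y w + L.l3 (L.l2 x w) y z + L.l3 (L.l2 y z) x w -
        L.l3 (L.l2 y w) x z + L.l3 (L.l2 z w) x y

variable (V₀ V₁ W₀ W₁) in
/-- The components of an L∞-morphism between two-term complexes: `f0`, `f1` are the components of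
the linear part in degrees 0 and 1 and `f2` is the binary part. -/
@[ext]
structure TwoTermMap where
  f0 : V₀ → W₀
  f1 : V₁ → W₁
  f2 : V₀ → V₀ → W₁

/-- Composition of L∞-morphisms. -/
def TwoTermMap.comp (g : TwoTermMap W₀ W₁ Z₀ Z₁) (f : TwoTermMap V₀ V₁ W₀ W₁) [AddCommGroup Z₁] :
    TwoTermMap V₀ V₁ Z₀ Z₁ where
  f0 x := g.f0 (f.f0 x)
  f1 h := g.f1 (f.f1 h)
  f2 x y := g.f1 (f.f2 x y) + g.f2 (f.f0 x) (f.f0 y)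

/-- The laws of an L∞-morphism between Lie 2-algebras. -/
structure TwoTermMap.IsMorphism (f : TwoTermMap V₀ V₁ W₀ W₁) (L : TwoTerm V₀ V₁)
    (M : TwoTerm W₀ W₁) : Prop where
  f0_linear : IsLinearMap ℝ f.f0
  f1_linear : IsLinearMap ℝ f.f1
  f2_linear : ∀ y, IsLinearMap ℝ fun x => f.f2 x y
  f2_skew : ∀ x y, f.f2 x y = -f.f2 y x
  comm : ∀ h, f.f0 (L.d h) = M.d (f.f1 h)
  bracket : ∀ x y, M.d (f.f2 x y) = f.f0 (L.l2 x y) - M.l2 (f.f0 x) (f.f0 y)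
  act : ∀ x h, f.f2 x (L.d h) = f.f1 (L.act x h) - M.act (f.f0 x) (f.f1 h)
  l3 : ∀ x y z, f.f1 (L.l3 x y z) - M.l3 (f.f0 x) (f.f0 y) (f.f0 z) =
    (f.f2 x (L.l2 y z) + M.act (f.f0 x) (f.f2 y z)) +
    (f.f2 y (L.l2 z x) + M.act (f.f0 y) (f.f2 z x)) +
    (f.f2 z (L.l2 x y) + M.act (f.f0 z) (f.f2 x y))

/-- A weak equivalence: an L∞-morphism whose linear part induces bijections on the homology
in degree 1, i.e. on `ker d`, and in degree 0, i.e. on the cokernel of `d`. -/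
structure TwoTermMap.IsWeakEquivalence (f : TwoTermMap V₀ V₁ W₀ W₁) (L : TwoTerm V₀ V₁)
    (M : TwoTerm W₀ W₁) : Prop extends f.IsMorphism L M where
  injective_H1 : ∀ h, L.d h = 0 → f.f1 h = 0 → h = 0
  surjective_H1 : ∀ k, M.d k = 0 → ∃ h, L.d h = 0 ∧ f.f1 h = k
  injective_H0 : ∀ x, (∃ k, M.d k = f.f0 x) → ∃ h, L.d h = x
  surjective_H0 : ∀ y, ∃ x k, y = f.f0 x + M.d k

end TwoTerm

section Geometry

variable {E X : Type*} [NormedAddCommGroup E] [NormedSpace ℝ E] [FiniteDimensional ℝ E]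
  [TopologicalSpace X] [ChartedSpace E X] [IsManifold 𝓘(ℝ, E) ∞ X]

open DForm

variable (E X) in
/-- A pre-2-plectic form: a closed 3-form, possibly degenerate. -/
structure Pre2Plectic where
  form : DForm E (⊤ : Opens X) 3
  closed : d form = 0

variable (om : Pre2Plectic E X)

/-- Hamiltonian pairs `v + H`, consisting of a vector field `v` and a 1-form `H`
with `ι_v ω + d H = 0`. -/
def hamPairs : Submodule ℝ (VField E X × DForm E (⊤ : Opens X) 1) :=
  LinearMap.ker (interior.flip om.form ∘ₗ LinearMap.fst ℝ _ _ + d ∘ₗ LinearMap.snd ℝ _ _)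

theorem mem_hamPairs {p : VField E X × DForm E (⊤ : Opens X) 1} :
    p ∈ hamPairs om ↔ interior p.1 om.form + d p.2 = 0 := Iff.rfl

theorem hamBracket_mem (x y : hamPairs om) :
    (vbracket x.1.1 y.1.1, interior y.1.1 (interior x.1.1 om.form)) ∈ hamPairs om := by
  have hx : interior x.1.1 om.form = -d x.1.2 := eq_neg_of_add_eq_zero_left x.2
  have hy : interior y.1.1 om.form = -d y.1.2 := eq_neg_of_add_eq_zero_left y.2
  rw [mem_hamPairs]
  change interior (vbracket x.1.1 y.1.1) om.form + d (interior y.1.1 (interior x.1.1 om.form)) = 0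
  rw [interior_vbracket, lie_succ, lie_succ, om.closed, interior_anticomm y.1.1 x.1.1]
  rw [hx, hy]
  simp only [map_neg, d_d]
  simp

/-- The Lie 2-algebra of Hamiltonian 1-forms of a pre-2-plectic manifold. -/
def hamLinf : TwoTerm (hamPairs om) (DForm E (⊤ : Opens X) 0) where
  d := (LinearMap.inr ℝ _ _ ∘ₗ d).codRestrict (hamPairs om) fun η => by
    rw [mem_hamPairs]
    simp [d_d]
  l2 x y := ⟨_, hamBracket_mem om x y⟩
  act _ _ := 0
  l3 x y z := -interior z.1.1 (interior y.1.1 (interior x.1.1 om.form))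

/-- The skew pairing `ι_{v₁} θ₂ - ι_{v₂} θ₁` of generalized vector fields. -/
def pairMinus (x y : VField E X × DForm E (⊤ : Opens X) 1) : DForm E (⊤ : Opens X) 0 :=
  interior x.1 y.2 - interior y.1 x.2

/-- The symmetric pairing `ι_{v₁} θ₂ + ι_{v₂} θ₁` of generalized vector fields. -/
def pairPlus (x y : VField E X × DForm E (⊤ : Opens X) 1) : DForm E (⊤ : Opens X) 0 :=
  interior x.1 y.2 + interior y.1 x.2

/-- The skew-symmetric Courant bracket twisted by `ω`. -/
def courantBracket (x y : VField E X × DForm E (⊤ : Opens X) 1) :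
    VField E X × DForm E (⊤ : Opens X) 1 :=
  (vbracket x.1 y.1, lie x.1 y.2 - lie y.1 x.2 - (1 / 2 : ℝ) • d (pairMinus x y) -
    interior y.1 (interior x.1 om.form))

/-- The Courant Lie 2-algebra. -/
def courantLinf : TwoTerm (VField E X × DForm E (⊤ : Opens X) 1) (DForm E (⊤ : Opens X) 0) where
  d := LinearMap.inr ℝ _ _ ∘ₗ d
  l2 := courantBracket om
  act x η := (1 / 2 : ℝ) • interior x.1 (d η)
  l3 x y z := -((1 / 6 : ℝ) • (pairPlus (courantBracket om x y) z +
    pairPlus (courantBracket om y z) x + pairPlus (courantBracket om z x) y))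

/-- The Atiyah Lie 2-algebra. -/
def atiyahLinf : TwoTerm (VField E X) (DForm E (⊤ : Opens X) 0) where
  d := 0
  l2 := vbracket
  act v η := lie v η
  l3 u v w := -interior w (interior v (interior u om.form))

/-- The embedding of the Hamiltonian Lie 2-algebra into the Courant Lie 2-algebra. -/
def mapPhi : TwoTermMap (hamPairs om) (DForm E (⊤ : Opens X) 0)
    (VField E X × DForm E (⊤ : Opens X) 1) (DForm E (⊤ : Opens X) 0) where
  f0 x := x.1
  f1 η := η
  f2 x y := -((1 / 2 : ℝ) • pairMinus x.1 y.1)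

/-- The projection of the Courant Lie 2-algebra onto the Atiyah Lie 2-algebra. -/
def mapPsi : TwoTermMap (VField E X × DForm E (⊤ : Opens X) 1) (DForm E (⊤ : Opens X) 0)
    (VField E X) (DForm E (⊤ : Opens X) 0) where
  f0 x := x.1
  f1 η := η
  f2 x y := -((1 / 2 : ℝ) • pairMinus x y)

variable {ι : Type*} {𝒰 : ι → Opens X} (A : DeligneCocycle E 𝒰)

/-- Pairs `v + θ` of a vector field and a cochain of total degree one. -/
abbrev VTot1 (𝒰 : ι → Opens X) : Type _ :=
  VField E X × FormFamily E 𝒰 1 × FormFamily E (inter2 𝒰) 0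

/-- Infinitesimal quantomorphisms: `L_v A = d_Tot θ` in all three components. -/
def quPairs : Submodule ℝ (VTot1 (E := E) 𝒰) :=
  LinearMap.eqLocus (A.lieTot ∘ₗ LinearMap.fst ℝ _ _) (dTot1 ∘ₗ LinearMap.snd ℝ _ _)

/-- Infinitesimal symmetries of the 2-cocycle without its curving: `L_v (A1 + A0) = d_Tot θ`, the
component of `d_Tot θ` in the 2-forms being discarded. -/
def couPairs : Submodule ℝ (VTot1 (E := E) 𝒰) :=
  LinearMap.eqLocus (LinearMap.snd ℝ _ _ ∘ₗ A.lieTot ∘ₗ LinearMap.fst ℝ _ _)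
    (LinearMap.snd ℝ _ _ ∘ₗ dTot1 ∘ₗ LinearMap.snd ℝ _ _)

/-- Infinitesimal symmetries of the 2-cocycle without its connection: pairs `v + θ⁰`
with `L_v A0 = δ θ⁰`. -/
def atPairs : Submodule ℝ (VField E X × FormFamily E (inter2 𝒰) 0) :=
  LinearMap.eqLocus (famInterior.flip A.dlogA0 ∘ₗ LinearMap.fst ℝ _ _)
    (cech1 ∘ₗ LinearMap.snd ℝ _ _)

theorem mem_quPairs {p : VTot1 (E := E) 𝒰} :
    p ∈ quPairs A ↔ famLie p.1 A.A2 = famD p.2.1 ∧ p ∈ couPairs A := by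
  change A.lieTot p.1 = dTot1 p.2 ↔ _
  rw [Prod.ext_iff]
  rfl

theorem mem_couPairs {p : VTot1 (E := E) 𝒰} :
    p ∈ couPairs A ↔ famLie p.1 A.A1 = cech0 p.2.1 - famD p.2.2 ∧
      (p.1, p.2.2) ∈ atPairs A := by
  change (A.lieTot p.1).2 = (dTot1 p.2).2 ↔ _
  rw [Prod.ext_iff]
  rfl

theorem mem_atPairs {p : VField E X × FormFamily E (inter2 𝒰) 0} :
    p ∈ atPairs A ↔ famInterior p.1 A.dlogA0 = cech1 p.2 := Iff.rfl

/-- The bracket `[v₁, v₂] + L_{v₁} θ₂ - L_{v₂} θ₁`. -/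
def totBracket (x y : VTot1 (E := E) 𝒰) : VTot1 (E := E) 𝒰 :=
  (vbracket x.1 y.1, famLie x.1 y.2.1 - famLie y.1 x.2.1, famLie x.1 y.2.2 - famLie y.1 x.2.2)

theorem atBracket_mem {x y : VField E X × FormFamily E (inter2 𝒰) 0} (hx : x ∈ atPairs A)
    (hy : y ∈ atPairs A) :
    (vbracket x.1 y.1, famLie x.1 y.2 - famLie y.1 x.2) ∈ atPairs A := by
  rw [mem_atPairs] at *
  change famInterior (vbracket x.1 y.1) A.dlogA0 = cech1 (famLie x.1 y.2 - famLie y.1 x.2)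
  rw [famInterior_vbracket, famLie_succ, A.famD_dlogA0, map_zero, add_zero, ← famLie_zero,
    hx, hy, famLie_cech1, famLie_cech1, map_sub]

theorem couBracket_mem {x y : VTot1 (E := E) 𝒰} (hx : x ∈ couPairs A) (hy : y ∈ couPairs A) :
    totBracket x y ∈ couPairs A := by
  rw [mem_couPairs] at *
  have h := atBracket_mem A hx.2 hy.2
  refine ⟨?_, h⟩
  change famLie (vbracket x.1 y.1) A.A1 = cech0 (famLie x.1 y.2.1 - famLie y.1 x.2.1) -
    famD (famLie x.1 y.2.2 - famLie y.1 x.2.2)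
  rw [famLie_vbracket, hx.1, hy.1]
  simp only [map_sub, famLie_cech0, famLie_famD]
  abel

theorem quBracket_mem {x y : VTot1 (E := E) 𝒰} (hx : x ∈ quPairs A) (hy : y ∈ quPairs A) :
    totBracket x y ∈ quPairs A := by
  rw [mem_quPairs] at *
  refine ⟨?_, couBracket_mem A hx.2 hy.2⟩
  change famLie (vbracket x.1 y.1) A.A2 = famD (famLie x.1 y.2.1 - famLie y.1 x.2.1)
  rw [famLie_vbracket, hx.1, hy.1]
  simp only [map_sub, famLie_famD]

theorem inr_dTot0_mem (η : FormFamily E 𝒰 0) : ((0 : VField E X), dTot0 η) ∈ quPairs A := by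
  change A.lieTot 0 = dTot1 (dTot0 η)
  rw [map_zero, dTot1_dTot0]

/-- The differential graded Lie algebra of infinitesimal quantomorphisms. -/
def dgLieQu : TwoTerm (quPairs A) (FormFamily E 𝒰 0) where
  d := (LinearMap.inr ℝ _ _ ∘ₗ dTot0).codRestrict (quPairs A) (inr_dTot0_mem A)
  l2 x y := ⟨totBracket x.1 y.1, quBracket_mem A x.2 y.2⟩
  act x η := famLie x.1.1 η
  l3 _ _ _ := 0

/-- The differential graded Lie algebra of infinitesimal symmetries of the cocycle without
its curving. -/
def dgLieCou : TwoTerm (couPairs A) (FormFamily E 𝒰 0) where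
  d := (LinearMap.inr ℝ _ _ ∘ₗ dTot0).codRestrict (couPairs A)
    fun η => ((mem_quPairs A).1 (inr_dTot0_mem A η)).2
  l2 x y := ⟨totBracket x.1 y.1, couBracket_mem A x.2 y.2⟩
  act x η := famLie x.1.1 η
  l3 _ _ _ := 0

/-- The differential graded Lie algebra of infinitesimal symmetries of the cocycle without
its connection. -/
def dgLieAt : TwoTerm (atPairs A) (FormFamily E 𝒰 0) where
  d := (LinearMap.inr ℝ _ _ ∘ₗ cech0).codRestrict (atPairs A)
    fun η => ((mem_couPairs A).1 ((mem_quPairs A).1 (inr_dTot0_mem A η)).2).2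
  l2 x y := ⟨(vbracket x.1.1 y.1.1, famLie x.1.1 y.1.2 - famLie y.1.1 x.1.2),
    atBracket_mem A x.2 y.2⟩
  act x η := famLie x.1.1 η
  l3 _ _ _ := 0

/-- The inclusion of the quantomorphism algebra. -/
def mapI : TwoTermMap (quPairs A) (FormFamily E 𝒰 0) (couPairs A) (FormFamily E 𝒰 0) where
  f0 x := ⟨x.1, ((mem_quPairs A).1 x.2).2⟩
  f1 η := η
  f2 _ _ := 0

/-- The projection forgetting the component in the 1-forms. -/
def mapP : TwoTermMap (couPairs A) (FormFamily E 𝒰 0) (atPairs A) (FormFamily E 𝒰 0) where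
  f0 x := ⟨(x.1.1, x.1.2.2), ((mem_couPairs A).1 x.2).2⟩
  f1 η := η
  f2 _ _ := 0

/-- The Čech 0-cochain `ι_{v₂} ι_{v₁} A2`. -/
def contractA2 (u v : VField E X) : FormFamily E 𝒰 0 := famInterior v (famInterior u A.A2)

variable {om A}

theorem at_mem (v : VField E X) : (v, -famInterior v A.A1) ∈ atPairs A := by
  rw [mem_atPairs]
  change famInterior v A.dlogA0 = cech1 (-famInterior v A.A1)
  rw [A.dlogA0_eq, map_neg, map_neg, famInterior_cech1]

theorem cou_mem (v : VField E X) (θ : DForm E (⊤ : Opens X) 1) :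
    ((v, -famRes 𝒰 θ + famInterior v A.A2, -famInterior v A.A1) : VTot1 (E := E) 𝒰) ∈
      couPairs A := by
  rw [mem_couPairs]
  refine ⟨?_, at_mem v⟩
  change famLie v A.A1 = cech0 (-famRes 𝒰 θ + famInterior v A.A2) - famD (-famInterior v A.A1)
  rw [famLie_succ, ← A.cocycle2, famInterior_cech0, map_add, map_neg, cech0_famRes, map_neg]
  abel

theorem qu_mem (hA : A.Prequantizes om.form) {x : VField E X × DForm E (⊤ : Opens X) 1}
    (hx : x ∈ hamPairs om) :
    ((x.1, -famRes 𝒰 x.2 + famInterior x.1 A.A2, -famInterior x.1 A.A1) : VTot1 (E := E) 𝒰) ∈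
      quPairs A := by
  rw [mem_quPairs]
  refine ⟨?_, cou_mem _ _⟩
  change famLie x.1 A.A2 = famD (-famRes 𝒰 x.2 + famInterior x.1 A.A2)
  have hA' : famD A.A2 = famRes 𝒰 om.form := hA
  have hx' : interior x.1 om.form = -d x.2 := eq_neg_of_add_eq_zero_left hx
  rw [famLie_succ, hA', famInterior_famRes, hx', map_add, map_neg,
    map_neg, famD_famRes]
  abel

/-- The morphism from the Hamiltonian Lie 2-algebra to the quantomorphism algebra. -/
def mapF (hA : A.Prequantizes om.form) :
    TwoTermMap (hamPairs om) (DForm E (⊤ : Opens X) 0) (quPairs A) (FormFamily E 𝒰 0) where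
  f0 x := ⟨_, qu_mem hA x.2⟩
  f1 η := -famRes 𝒰 η
  f2 x y := famRes 𝒰 (pairMinus x.1 y.1) + contractA2 A x.1.1 y.1.1

variable (A)

/-- The morphism from the Courant Lie 2-algebra. -/
def mapFc : TwoTermMap (VField E X × DForm E (⊤ : Opens X) 1) (DForm E (⊤ : Opens X) 0)
    (couPairs A) (FormFamily E 𝒰 0) where
  f0 x := ⟨_, cou_mem x.1 x.2⟩
  f1 η := -famRes 𝒰 η
  f2 x y := (1 / 2 : ℝ) • famRes 𝒰 (pairMinus x y) + contractA2 A x.1 y.1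

/-- The morphism from the Atiyah Lie 2-algebra. -/
def mapFa : TwoTermMap (VField E X) (DForm E (⊤ : Opens X) 0) (atPairs A)
    (FormFamily E 𝒰 0) where
  f0 v := ⟨_, at_mem v⟩
  f1 η := -famRes 𝒰 η
  f2 u v := contractA2 A u v

end Geometry

end HigherPrequantum

end

open HigherPrequantum

/-!
The algebraic half of the statement is Cartan calculus. Every law of a Lie 2-algebra or of a
morphism is an identity between forms built from contractions, Lie derivatives and brackets of
vector fields. Moving Lie derivatives to the left with `[L_u, ι_v] = ι_[u, v]` (`interior_lie`) and
expanding `L_[u, v]` and the Jacobi identity brings both sides to a common normal form, up to the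
relations `d ω = 0` and `d A² = ω`. These two enter only through Cartan's formula for the exterior
derivative of a form evaluated on vector fields: `d_interior_of_closed` and `cartan_of_closed` for
`ω`, and `DeligneCocycle.Prequantizes.contractA2_cyclic` and
`DeligneCocycle.Prequantizes.famD_contractA2` for `A²`. On Hamiltonian pairs, the invariance
`L_v ω = 0` (`lie_eq_zero_of_mem_hamPairs`) additionally turns derivatives of contractions of `ω`
into brackets. The longest such computation is the last law of the Courant Lie 2-algebra,
`courantLinf_jacobi_l3`, which starts from the expanded ternary bracket `courantLinf_l3`.

The homological half is that differential forms are a fine sheaf. Čech 0-cocycles are global forms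
(`exists_famRes_eq`); this determines the homology in degree 1 and shows injectivity on homology in
degree 0. Surjectivity in degree 0 also needs that Čech 1-cocycles are coboundaries
(`exists_cech0_eq`), which follows from a smooth partition of unity: for a symmetry `v + θ¹ + θ⁰`,
the relations `L_v A⁰ = δ θ⁰` and `δ A¹ = -dlog A⁰` make `θ⁰ + ι_v A¹` a 1-cocycle, hence equal to
`δ k`, and then `θ¹ - ι_v A² - d k` is a 0-cocycle, hence a global form `-θ`. The symmetry is thus
the image of `v + θ` up to the coboundary of `k` (`exists_eq_of_mem_couPairs`), and the condition
`L_v A² = d θ¹` says exactly that `v + θ` is Hamiltonian.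
-/

namespace HigherPrequantum

/-! ### Vector fields and Cartan formulas -/

section VectorFields

variable {E X : Type*} [NormedAddCommGroup E] [NormedSpace ℝ E] [TopologicalSpace X]
  [ChartedSpace E X] [IsManifold 𝓘(ℝ, E) ∞ X]

theorem VField.mdifferentiableAt (u : VField E X) (x : X) :
    MDifferentiableAt 𝓘(ℝ, E) (𝓘(ℝ, E).prod 𝓘(ℝ, E))
      (fun x => (⟨x, u x⟩ : TangentBundle 𝓘(ℝ, E) X)) x :=
  (u.contMDiff x).mdifferentiableAt (by simp)

variable [FiniteDimensional ℝ E]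

theorem vbracket_add_left (u u' v : VField E X) :
    vbracket (u + u') v = vbracket u v + vbracket u' v :=
  ContMDiffSection.ext fun x =>
    VectorField.mlieBracket_add_left (u.mdifferentiableAt x) (u'.mdifferentiableAt x)

theorem vbracket_smul_left (c : ℝ) (u v : VField E X) :
    vbracket (c • u) v = c • vbracket u v :=
  ContMDiffSection.ext fun x =>
    VectorField.mlieBracket_const_smul_left (u.mdifferentiableAt x)

theorem vbracket_skew (u v : VField E X) : vbracket u v = -vbracket v u :=
  ContMDiffSection.ext fun _ => VectorField.mlieBracket_swap_apply

theorem vbracket_jacobi (u v w : VField E X) :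
    vbracket (vbracket u v) w + vbracket (vbracket v w) u + vbracket (vbracket w u) v = 0 := by
  have := FiniteDimensional.complete ℝ E
  have hn : minSmoothness ℝ 3 ≤ ∞ := by
    rw [minSmoothness_of_isRCLikeNormedField]; exact ENat.LEInfty.out
  have hn' : minSmoothness ℝ 2 ≤ ∞ := by
    rw [minSmoothness_of_isRCLikeNormedField]; exact ENat.LEInfty.out
  have : IsManifold 𝓘(ℝ, E) (minSmoothness ℝ 3) X := .of_le hn
  have h : vbracket u (vbracket v w) = vbracket (vbracket u v) w + vbracket v (vbracket u w) :=
    ContMDiffSection.ext fun x => VectorField.leibniz_identity_mlieBracket_apply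
      ((u.contMDiff x).of_le hn') ((v.contMDiff x).of_le hn') ((w.contMDiff x).of_le hn')
  have h2 : vbracket v (vbracket u w) = vbracket (vbracket w u) v := by
    rw [vbracket_skew v, vbracket_skew u w, ← neg_one_smul ℝ (vbracket w u), vbracket_smul_left]
    module
  rw [vbracket_skew (vbracket v w) u, h, h2]
  abel

/-- The Lie bracket as a bilinear map. -/
noncomputable def vbracketₗ : VField E X →ₗ[ℝ] VField E X →ₗ[ℝ] VField E X :=
  LinearMap.mk₂ ℝ vbracket vbracket_add_left vbracket_smul_left
    (fun u v w => by
      rw [vbracket_skew, vbracket_add_left, neg_add, ← vbracket_skew, ← vbracket_skew])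
    (fun c u v => by
      rw [vbracket_skew, vbracket_smul_left, ← smul_neg, ← vbracket_skew])

theorem vbracket_add_right (u v v' : VField E X) :
    vbracket u (v + v') = vbracket u v + vbracket u v' :=
  map_add (vbracketₗ u) v v'

theorem vbracket_smul_right (c : ℝ) (u v : VField E X) :
    vbracket u (c • v) = c • vbracket u v :=
  map_smul (vbracketₗ u) c v

theorem vbracket_neg_left (u v : VField E X) : vbracket (-u) v = -vbracket u v :=
  LinearMap.map_neg₂ vbracketₗ u v

theorem vbracket_zero_left (v : VField E X) : vbracket 0 v = 0 :=
  LinearMap.map_zero₂ vbracketₗ v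

theorem vbracket_zero_right (v : VField E X) : vbracket v 0 = 0 :=
  map_zero (vbracketₗ v)

/-- The Jacobi identity, solved for the nested bracket in which the first field is outermost. -/
theorem vbracket_vbracket_cycle (u v w : VField E X) :
    vbracket (vbracket v w) u = vbracket (vbracket u w) v - vbracket (vbracket u v) w := by
  have h := vbracket_jacobi u v w
  rw [vbracket_skew w u, vbracket_neg_left] at h
  rw [← sub_eq_zero, ← h]
  abel

end VectorFields

section CartanFormulas

variable {E X : Type*} [NormedAddCommGroup E] [NormedSpace ℝ E] [FiniteDimensional ℝ E]
  [TopologicalSpace X] [ChartedSpace E X] [IsManifold 𝓘(ℝ, E) ∞ X] {U : Opens X} {k : ℕ}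

namespace DForm

theorem interior_lie (u v : VField E X) (a : DForm E U (k + 1)) :
    interior v (lie u a) = lie u (interior v a) - interior (vbracket u v) a := by
  rw [interior_vbracket]; abel

theorem interior_d (v : VField E X) (a : DForm E U (k + 1)) :
    interior v (d a) = lie v a - d (interior v a) := by
  rw [lie_succ]; abel

/-- Cartan's formula for the exterior derivative of a 1-form. -/
theorem interior_interior_d (u v : VField E X) (a : DForm E U 1) :
    interior v (interior u (d a)) =
      lie u (interior v a) - lie v (interior u a) - interior (vbracket u v) a := by
  rw [interior_d, map_sub, interior_lie, lie_zero v]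
  abel

/-- Cartan's formula for the exterior derivative of a 2-form. -/
theorem interior_interior_interior_d (u v w : VField E X) (a : DForm E U 2) :
    interior w (interior v (interior u (d a))) =
      (interior (vbracket v w) (interior u a) + lie u (interior w (interior v a))) +
      (interior (vbracket w u) (interior v a) + lie v (interior u (interior w a))) +
      (interior (vbracket u v) (interior w a) + lie w (interior v (interior u a))) := by
  rw [interior_d, map_sub, map_sub, interior_lie, map_sub, interior_lie, interior_interior_d,
    vbracket_skew w u, LinearMap.map_neg₂, interior_anticomm w (vbracket u v),
    interior_anticomm u w, map_neg]
  abel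

/-- Cartan's formula for three contractions of the exterior derivative, for a closed form. -/
theorem d_interior_of_closed (u v w : VField E X) {a : DForm E U (k + 3)} (ha : d a = 0) :
    d (interior w (interior v (interior u a))) =
      lie u (interior w (interior v a)) + lie v (interior u (interior w a))
        + lie w (interior v (interior u a)) - interior w (interior (vbracket u v) a)
        - interior u (interior (vbracket v w) a) - interior v (interior (vbracket w u) a) := by
  have h : interior w (interior v (interior u (d a))) = 0 := by
    rw [ha]; simp only [map_zero]
  rw [interior_d, map_sub, map_sub, interior_lie, map_sub, interior_lie, interior_d, map_sub,
    interior_lie, interior_d] at h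
  rw [vbracket_skew w u, interior_anticomm u w, map_neg interior, map_neg (lie v),
    LinearMap.neg_apply, map_neg, interior_anticomm v (vbracket u w),
    interior_anticomm u (vbracket v w), ← sub_eq_zero, ← neg_eq_zero, ← h]
  abel

/-- Cartan's formula for the exterior derivative of a 3-form, for a closed form. -/
theorem cartan_of_closed (u v w t : VField E X) {a : DForm E U 3} (ha : d a = 0) :
    lie u (interior t (interior w (interior v a))) - lie v (interior t (interior w (interior u a)))
      + lie w (interior t (interior v (interior u a)))
      - lie t (interior w (interior v (interior u a))) =
    interior t (interior w (interior (vbracket u v) a))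
      - interior t (interior v (interior (vbracket u w) a))
      + interior w (interior v (interior (vbracket u t) a))
      + interior t (interior u (interior (vbracket v w) a))
      - interior w (interior u (interior (vbracket v t) a))
      + interior v (interior u (interior (vbracket w t) a)) := by
  have h : interior t (interior w (interior v (interior u (d a)))) = 0 := by
    rw [ha]; simp only [map_zero]
  rw [interior_d, map_sub, map_sub, map_sub, interior_interior_interior_d, interior_lie, map_sub,
    map_sub, interior_lie, map_sub, interior_lie] at h
  -- Contractions are sorted into a fixed order, those with brackets being applied first.
  have hb := fun (p q x : VField E X) (b : DForm E U 3) => interior_anticomm (vbracket p q) x b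
  have hb' := fun (p q x : VField E X) (b : DForm E U 2) => interior_anticomm (vbracket p q) x b
  simp only [vbracket_skew t v, LinearMap.neg_apply, map_neg, neg_neg, hb, hb',
    interior_anticomm v t] at h ⊢
  rw [← sub_eq_zero, ← h]
  abel
end DForm

section Families

variable {κ : Type*} {V : κ → Opens X}

theorem famLie_famRes (v : VField E X) (a : DForm E (⊤ : Opens X) k) :
    famLie v (famRes V a) = famRes V (DForm.lie v a) :=
  funext fun _ => DForm.lie_res le_top _ _

theorem famInterior_anticomm (u v : VField E X) (a : FormFamily E V (k + 2)) :
    famInterior u (famInterior v a) = -famInterior v (famInterior u a) :=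
  funext fun _ => DForm.interior_anticomm _ _ _

theorem famInterior_interior_interior_d (u v w : VField E X) (a : FormFamily E V 2) :
    famInterior w (famInterior v (famInterior u (famD a))) =
      (famInterior (vbracket v w) (famInterior u a) + famLie u (famInterior w (famInterior v a))) +
      (famInterior (vbracket w u) (famInterior v a) + famLie v (famInterior u (famInterior w a))) +
      (famInterior (vbracket u v) (famInterior w a) + famLie w (famInterior v (famInterior u a))) :=
  funext fun _ => DForm.interior_interior_interior_d _ _ _ _

end Families

end CartanFormulas

/-! ### Differential forms as a fine sheaf -/

section Gluing

variable {E X : Type*} [NormedAddCommGroup E] [NormedSpace ℝ E] [TopologicalSpace X]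
  [ChartedSpace E X] {k : ℕ}

theorem isSmoothOn_zero (U : Set X) : IsSmoothOn (E := E) U (0 : ∀ x : X, AltAt E k x) :=
  fun _ => contDiffOn_const (c := 0)

theorem IsSmoothOn.add {U : Set X} {α β : ∀ x : X, AltAt E k x} (hα : IsSmoothOn U α)
    (hβ : IsSmoothOn U β) : IsSmoothOn U (α + β) := fun x₀ => by
  rw [chartRep_add]; exact (hα x₀).add (hβ x₀)

theorem IsSmoothOn.sum {κ : Type*} {U : Set X} {α : κ → ∀ x : X, AltAt E k x} (s : Finset κ)
    (hα : ∀ i ∈ s, IsSmoothOn U (α i)) : IsSmoothOn U (∑ i ∈ s, α i) :=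
  Finset.sum_induction _ (IsSmoothOn U) (fun _ _ => IsSmoothOn.add) (isSmoothOn_zero U) hα

/-- Smoothness of a field of alternating forms is a local property. -/
theorem isSmoothOn_of_locally {U : Set X} {α : ∀ x : X, AltAt E k x}
    (h : ∀ x ∈ U, ∃ V : Set X, IsOpen V ∧ x ∈ V ∧ IsSmoothOn V α) : IsSmoothOn U α := by
  intro x₀ y hy
  obtain ⟨V, hV, hx, hα⟩ := h _ hy.2
  exact (hα.contDiffAt hV hy.1 hx).contDiffWithinAt

theorem IsSmoothOn.smul [IsManifold 𝓘(ℝ, E) ∞ X] {U : Set X} {α : ∀ x : X, AltAt E k x}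
    (hα : IsSmoothOn U α) {f : X → ℝ} (hf : ContMDiff 𝓘(ℝ, E) 𝓘(ℝ, ℝ) ∞ f) :
    IsSmoothOn U (fun x => f x • α x) := by
  intro x₀
  have h : ContDiffOn ℝ ∞ (f ∘ (chartAt E x₀).symm) (chartAt E x₀).target :=
    contMDiffOn_iff_contDiffOn.1 (hf.comp_contMDiffOn
      (contMDiffOn_symm_of_mem_maximalAtlas (IsManifold.chart_mem_maximalAtlas x₀)))
  exact (h.mono Set.inter_subset_left).smul (hα x₀)

variable {ι : Type*} {𝒰 : ι → Opens X}

theorem DForm.toField_sub {U : Opens X} (a b : DForm E U k) (x : X) :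
    (a - b).toField x = a.toField x - b.toField x := by
  have : a - b = a + (-1 : ℝ) • b := by module
  rw [this, DForm.toField_add, DForm.toField_smul, Pi.add_apply, Pi.smul_apply]
  module

theorem DForm.toField_zero {U : Opens X} (x : X) : (0 : DForm E U k).toField x = 0 := by
  rw [← sub_self (0 : DForm E U k), DForm.toField_sub, sub_self]

theorem DForm.toField_res {U V : Opens X} (h : V ≤ U) (a : DForm E U k) {x : X} (hx : x ∈ V) :
    (DForm.res h a).toField x = a.toField x :=
  DForm.toField_ofField (a.smooth.mono h) hx

theorem cech0_toField (a : FormFamily E 𝒰 k) (i j : ι) {x : X} (hi : x ∈ 𝒰 i) (hj : x ∈ 𝒰 j) :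
    (cech0 a (i, j)).toField x = (a j).toField x - (a i).toField x := by
  have hx : x ∈ inter2 𝒰 (i, j) := ⟨hi, hj⟩
  change (DForm.res (inter2_le_right i j) (a j) - DForm.res (inter2_le_left i j) (a i)).toField x
    = _
  rw [DForm.toField_sub, DForm.toField_res _ _ hx, DForm.toField_res _ _ hx]

theorem cech1_toField (c : FormFamily E (inter2 𝒰) k) (i j l : ι) {x : X} (hi : x ∈ 𝒰 i)
    (hj : x ∈ 𝒰 j) (hl : x ∈ 𝒰 l) :
    (cech1 c (i, j, l)).toField x =
      (c (j, l)).toField x - (c (i, l)).toField x + (c (i, j)).toField x := by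
  have hx : x ∈ inter3 𝒰 (i, j, l) := ⟨⟨hi, hj⟩, hl⟩
  change (DForm.res (inter3_le_right i j l) (c (j, l)) - DForm.res (inter3_le_outer i j l)
    (c (i, l)) + DForm.res (inter3_le_left i j l) (c (i, j))).toField x = _
  rw [DForm.toField_add, Pi.add_apply, DForm.toField_sub, DForm.toField_res _ _ hx,
    DForm.toField_res _ _ hx, DForm.toField_res _ _ hx]

theorem famRes_injective (h𝒰 : ⨆ i, 𝒰 i = ⊤) :
    Function.Injective (famRes 𝒰 : DForm E (⊤ : Opens X) k →ₗ[ℝ] FormFamily E 𝒰 k) := by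
  intro a b hab
  apply DForm.ext_field
  intro x hx
  rw [← h𝒰] at hx
  obtain ⟨i, hi⟩ := Opens.mem_iSup.1 hx
  have h : DForm.res le_top a = DForm.res le_top b := congrFun hab i
  rw [← DForm.toField_res (le_top : 𝒰 i ≤ ⊤) a hi, h, DForm.toField_res _ _ hi]

/-- The sheaf property of differential forms: a Čech 0-cocycle is a global form. -/
theorem exists_famRes_eq (h𝒰 : ⨆ i, 𝒰 i = ⊤) {a : FormFamily E 𝒰 k} (ha : cech0 a = 0) :
    ∃ b : DForm E (⊤ : Opens X) k, famRes 𝒰 b = a := by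
  have hcov : ∀ x : X, ∃ i, x ∈ 𝒰 i := fun x =>
    Opens.mem_iSup.1 (h𝒰 ▸ Opens.mem_top x)
  choose i hi using hcov
  have heq : ∀ (j : ι) (x : X), x ∈ 𝒰 j → (a (i x)).toField x = (a j).toField x := by
    intro j x hj
    have h := cech0_toField a (i x) j (hi x) hj
    rw [ha, Pi.zero_apply, DForm.toField_zero] at h
    exact (sub_eq_zero.1 h.symm).symm
  have hs : IsSmoothOn ((⊤ : Opens X) : Set X) (fun x => (a (i x)).toField x) :=
    isSmoothOn_of_locally fun x _ =>
      ⟨𝒰 (i x), (𝒰 (i x)).isOpen, hi x, (a (i x)).smooth.congr fun y hy => heq _ y hy⟩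
  refine ⟨DForm.ofField _ hs, funext fun j => DForm.ext_field fun x hx => ?_⟩
  change (DForm.res le_top (DForm.ofField _ hs)).toField x = _
  rw [DForm.toField_res _ _ hx, DForm.toField_ofField hs (Opens.mem_top x), heq j x hx]

/-- `exists_famRes_eq` with the sign that occurs in the linear parts of the vertical morphisms. -/
theorem exists_neg_famRes_eq (h𝒰 : ⨆ i, 𝒰 i = ⊤) {a : FormFamily E 𝒰 k}
    (ha : cech0 a = 0) : ∃ b : DForm E (⊤ : Opens X) k, -famRes 𝒰 b = a := by
  obtain ⟨b, rfl⟩ := exists_famRes_eq h𝒰 ha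
  exact ⟨-b, by rw [map_neg, neg_neg]⟩

theorem eq_zero_of_neg_famRes_eq_zero (h𝒰 : ⨆ i, 𝒰 i = ⊤)
    {b : DForm E (⊤ : Opens X) k} (hb : -famRes 𝒰 b = 0) : b = 0 :=
  famRes_injective h𝒰 (by rw [map_zero, ← neg_eq_zero, hb])

variable [IsManifold 𝓘(ℝ, E) ∞ X]

/-- A form multiplied with a smooth function extends by zero across the complement of the support
of that function. -/
theorem isSmoothOn_smul_of_tsupport_subset {U V W : Opens X} {f : X → ℝ}
    (hf : ContMDiff 𝓘(ℝ, E) 𝓘(ℝ, ℝ) ∞ f) (hU : tsupport f ⊆ U) (hW : U ⊓ V ≤ W)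
    (c : DForm E W k) : IsSmoothOn (V : Set X) (fun x => f x • c.toField x) := by
  apply isSmoothOn_of_locally
  intro x hx
  by_cases hxf : x ∈ tsupport f
  · exact ⟨U ⊓ V, (U ⊓ V).isOpen, ⟨hU hxf, hx⟩, (c.smooth.smul hf).mono hW⟩
  · refine ⟨(tsupport f)ᶜ, (isClosed_tsupport f).isOpen_compl, hxf,
      (isSmoothOn_zero _).congr fun y hy => ?_⟩
    rw [image_eq_zero_of_notMem_tsupport hy, zero_smul]
    rfl

/-- Differential forms are a fine sheaf: for a partition of unity `ρ` subordinate to the cover,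
`b_j = ∑ i, ρ_i c_{ij}` is a primitive of the Čech 1-cocycle `c`. -/
theorem exists_cech0_eq [FiniteDimensional ℝ E] [T2Space X] [SecondCountableTopology X]
    (h𝒰 : ⨆ i, 𝒰 i = ⊤) {c : FormFamily E (inter2 𝒰) k}
    (hc : cech1 c = 0) : ∃ b : FormFamily E 𝒰 k, cech0 b = c := by
  have : LocallyCompactSpace X := ChartedSpace.locallyCompactSpace E X
  obtain ⟨ρ, hρ⟩ := SmoothPartitionOfUnity.exists_isSubordinate 𝓘(ℝ, E) isClosed_univ
    (fun i => (𝒰 i : Set X)) (fun i => (𝒰 i).isOpen) (by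
      intro x _
      obtain ⟨i, hi⟩ := Opens.mem_iSup.1 (show x ∈ ⨆ i, 𝒰 i from h𝒰 ▸ Opens.mem_top x)
      exact Set.mem_iUnion.2 ⟨i, hi⟩)
  have hfin : ∀ x, (Function.support fun i => ρ i x).Finite := fun x =>
    ρ.locallyFinite.point_finite x
  have hterm : ∀ i j, IsSmoothOn (𝒰 j : Set X) (fun x => ρ i x • (c (i, j)).toField x) :=
    fun i j => isSmoothOn_smul_of_tsupport_subset (ρ i).contMDiff (hρ i) le_rfl _
  have hs : ∀ j, IsSmoothOn (𝒰 j : Set X) (fun x => ∑ᶠ i, ρ i x • (c (i, j)).toField x) := by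
    intro j
    apply isSmoothOn_of_locally
    intro x hx
    obtain ⟨N, hN, hNf⟩ := ρ.locallyFinite x
    obtain ⟨V, hVN, hV, hxV⟩ := mem_nhds_iff.1 hN
    refine ⟨V ∩ 𝒰 j, hV.inter (𝒰 j).isOpen, ⟨hxV, hx⟩, ?_⟩
    refine ((IsSmoothOn.sum hNf.toFinset fun i _ => hterm i j).mono
      Set.inter_subset_right).congr fun y hy => ?_
    rw [Finset.sum_apply]
    refine finsum_eq_sum_of_support_subset _ fun i hi => ?_
    rw [Function.mem_support] at hi
    exact hNf.mem_toFinset.2 ⟨y, left_ne_zero_of_smul hi, hVN hy.1⟩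
  refine ⟨fun j => DForm.ofField _ (hs j), funext fun ⟨j, l⟩ => DForm.ext_field fun x hx => ?_⟩
  have hsupp : ∀ j : ι, (Function.support fun i => ρ i x • (c (i, j)).toField x).Finite :=
    fun j => (hfin x).subset fun _ hi => left_ne_zero_of_smul hi
  rw [cech0_toField _ _ _ hx.1 hx.2, DForm.toField_ofField (hs j) hx.1,
    DForm.toField_ofField (hs l) hx.2, ← finsum_sub_distrib (hsupp l) (hsupp j)]
  have hcoc : ∀ i, ρ i x • (c (i, l)).toField x - ρ i x • (c (i, j)).toField x =
      ρ i x • (c (j, l)).toField x := by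
    intro i
    by_cases hi : x ∈ 𝒰 i
    · have h := cech1_toField c i j l hi hx.1 hx.2
      rw [hc, Pi.zero_apply, DForm.toField_zero] at h
      exact (smul_sub (ρ i x) ((c (i, l)).toField x) ((c (i, j)).toField x)).symm.trans
        (congrArg (ρ i x • ·) (by rw [← sub_eq_zero, ← neg_eq_zero, h]; abel))
    · rw [image_eq_zero_of_notMem_tsupport fun h => hi (hρ i h)]
      simp only [zero_smul, sub_self]
  rw [finsum_congr hcoc]
  refine (finsum_smul (fun i => ρ i x) ((c (j, l)).toField x)).symm.trans ?_
  rw [ρ.sum_eq_one (Set.mem_univ x), one_smul]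

end Gluing

/-! ### The Hamiltonian and Atiyah Lie 2-algebras -/

section Algebras

variable {E X : Type*} [NormedAddCommGroup E] [NormedSpace ℝ E] [FiniteDimensional ℝ E]
  [TopologicalSpace X] [ChartedSpace E X] [IsManifold 𝓘(ℝ, E) ∞ X] (om : Pre2Plectic E X)

open DForm

theorem lie_eq_zero_of_mem_hamPairs (x : hamPairs om) : lie x.1.1 om.form = 0 := by
  have hx : interior x.1.1 om.form = -d x.1.2 := eq_neg_of_add_eq_zero_left x.2
  rw [lie_succ, om.closed, hx, map_neg, d_d, map_zero, neg_zero, add_zero]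

theorem lie_interior {U : Opens X} {k : ℕ} (u v : VField E X) (a : DForm E U (k + 1)) :
    lie u (interior v a) = interior v (lie u a) + interior (vbracket u v) a := by
  rw [interior_lie]; abel

/-- The Leibniz rule for two contractions of an invariant form. -/
theorem lie_interior_interior {U : Opens X} {k : ℕ} (u v w : VField E X) {a : DForm E U (k + 2)}
    (h : lie u a = 0) : lie u (interior w (interior v a)) =
      interior (vbracket u w) (interior v a) + interior w (interior (vbracket u v) a) := by
  rw [lie_interior, lie_interior, h, map_zero, zero_add, add_comm]

/-- The Leibniz rule for three contractions of an invariant form. -/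
theorem lie_interior_interior_interior {U : Opens X} {k : ℕ} (u v w t : VField E X)
    {a : DForm E U (k + 3)} (h : lie u a = 0) :
    lie u (interior t (interior w (interior v a))) =
      interior (vbracket u t) (interior w (interior v a)) +
      interior t (interior (vbracket u w) (interior v a)) +
      interior t (interior w (interior (vbracket u v) a)) := by
  rw [lie_interior, lie_interior_interior u v w h, map_add]
  abel

theorem hamLinf_isLie2Algebra : (hamLinf om).IsLie2Algebra where
  l2_linear y := by
    refine ⟨fun x x' => ?_, fun c x => ?_⟩ <;>
      refine Subtype.ext (Prod.ext ?_ ?_) <;>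
      simp [hamLinf, vbracket_add_left, vbracket_smul_left]
  act_linear_left h := ⟨fun _ _ => (add_zero _).symm, fun _ _ => (smul_zero _).symm⟩
  act_linear_right h := ⟨fun _ _ => (add_zero _).symm, fun _ _ => (smul_zero _).symm⟩
  l3_linear y z := by
    refine ⟨fun x x' => ?_, fun c x => ?_⟩ <;> simp [hamLinf]
    abel
  l2_skew x y := Subtype.ext (Prod.ext (vbracket_skew _ _) (interior_anticomm _ _ _))
  l3_skew_left x y z := by
    simp only [hamLinf]; rw [interior_anticomm x.1.1 y.1.1, map_neg, neg_neg]
  l3_skew_right x y z := by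
    simp only [hamLinf]; rw [interior_anticomm z.1.1 y.1.1]
  d_act x h := by
    refine Subtype.ext (Prod.ext ?_ ?_) <;> simp [hamLinf, vbracket_zero_right]
  act_d h k := neg_zero.symm
  jacobi x y z := by
    refine Subtype.ext (Prod.ext ?_ ?_)
    · simpa [hamLinf] using vbracket_jacobi x.1.1 y.1.1 z.1.1
    · change d (-interior z.1.1 (interior y.1.1 (interior x.1.1 om.form)))
        + interior z.1.1 (interior (vbracket x.1.1 y.1.1) om.form)
        + interior x.1.1 (interior (vbracket y.1.1 z.1.1) om.form)
        + interior y.1.1 (interior (vbracket z.1.1 x.1.1) om.form) = 0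
      rw [map_neg, d_interior_of_closed _ _ _ om.closed]
      rw [lie_interior_interior _ _ _ (lie_eq_zero_of_mem_hamPairs om x),
        lie_interior_interior _ _ _ (lie_eq_zero_of_mem_hamPairs om y),
        lie_interior_interior _ _ _ (lie_eq_zero_of_mem_hamPairs om z),
        interior_anticomm (vbracket x.1.1 z.1.1), interior_anticomm (vbracket y.1.1 x.1.1),
        interior_anticomm (vbracket z.1.1 y.1.1), vbracket_skew x.1.1 z.1.1,
        vbracket_skew y.1.1 x.1.1, vbracket_skew z.1.1 y.1.1]
      simp only [map_neg, LinearMap.neg_apply]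
      abel
  jacobi_act x y h := by simp [hamLinf]
  jacobi_l3 x y z t := by
    have h := cartan_of_closed x.1.1 y.1.1 z.1.1 t.1.1 om.closed
    rw [lie_interior_interior_interior _ _ _ _ (lie_eq_zero_of_mem_hamPairs om x),
      lie_interior_interior_interior _ _ _ _ (lie_eq_zero_of_mem_hamPairs om y),
      lie_interior_interior_interior _ _ _ _ (lie_eq_zero_of_mem_hamPairs om z),
      lie_interior_interior_interior _ _ _ _ (lie_eq_zero_of_mem_hamPairs om t)] at h
    have hb := fun (p q x : VField E X) => interior_anticomm (vbracket p q) x om.form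
    have hb' := fun (p q x : VField E X) (b : DForm E (⊤ : Opens X) 2) =>
      interior_anticomm (vbracket p q) x b
    simp only [vbracket_skew y.1.1 x.1.1, vbracket_skew z.1.1 x.1.1, vbracket_skew z.1.1 y.1.1,
      vbracket_skew t.1.1 x.1.1, vbracket_skew t.1.1 y.1.1, vbracket_skew t.1.1 z.1.1,
      LinearMap.neg_apply, map_neg, neg_neg, hb, hb'] at h
    simp only [hamLinf]
    linear_combination (norm := module) h
theorem atiyahLinf_isLie2Algebra : (atiyahLinf om).IsLie2Algebra where
  l2_linear y := ⟨fun _ _ => vbracket_add_left _ _ _, fun _ _ => vbracket_smul_left _ _ _⟩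
  act_linear_left h := ⟨fun x y => LinearMap.map_add₂ lie x y h,
    fun c x => LinearMap.map_smul₂ lie c x h⟩
  act_linear_right x := ⟨map_add (lie x), map_smul (lie x)⟩
  l3_linear y z := by
    refine ⟨fun x x' => ?_, fun c x => ?_⟩ <;> simp [atiyahLinf]
    abel
  l2_skew := vbracket_skew
  l3_skew_left x y z := by
    simp only [atiyahLinf]; rw [interior_anticomm x y, map_neg, neg_neg]
  l3_skew_right x y z := by
    simp only [atiyahLinf]; rw [interior_anticomm z y]
  d_act x h := (vbracket_zero_right x).symm
  act_d h k := by simp [atiyahLinf]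
  jacobi x y z := by simpa [atiyahLinf] using vbracket_jacobi x y z
  jacobi_act x y h := by simp [atiyahLinf, lie_vbracket]
  jacobi_l3 x y z t := by
    have h := cartan_of_closed x y z t om.closed
    simp only [atiyahLinf, map_neg]
    linear_combination (norm := module) -h

end Algebras

/-! ### The Courant Lie 2-algebra -/

section Courant

variable {E X : Type*} [NormedAddCommGroup E] [NormedSpace ℝ E] [FiniteDimensional ℝ E]
  [TopologicalSpace X] [ChartedSpace E X] [IsManifold 𝓘(ℝ, E) ∞ X] (om : Pre2Plectic E X)

open DForm

theorem interior_d_function {U : Opens X} (v : VField E X) (f : DForm E U 0) :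
    interior v (d f) = lie v f := rfl

/-- The commutator `[ι_v, L_u] = -ι_[u, v]` on 1-forms, a special case of `interior_lie` stated so
that it applies when the degree is the numeral `1`. -/
theorem interior_lie_one {U : Opens X} (u v : VField E X) (a : DForm E U 1) :
    interior v (lie u a) = lie u (interior v a) - interior (vbracket u v) a :=
  interior_lie u v a

/-- The ternary bracket of the Courant Lie 2-algebra, with the contractions of Lie derivatives
expanded. -/
theorem courantLinf_l3 (x y z : VField E X × DForm E (⊤ : Opens X) 1) :
    (courantLinf om).l3 x y z =
      (1 / 2 : ℝ) • interior z.1 (interior y.1 (interior x.1 om.form)) -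
      (1 / 2 : ℝ) • (interior (vbracket x.1 y.1) z.2 + interior (vbracket y.1 z.1) x.2 +
        interior (vbracket z.1 x.1) y.2) -
      (1 / 4 : ℝ) • (lie y.1 (interior x.1 z.2) - lie x.1 (interior y.1 z.2) +
        (lie z.1 (interior y.1 x.2) - lie y.1 (interior z.1 x.2)) +
        (lie x.1 (interior z.1 y.2) - lie z.1 (interior x.1 y.2))) := by
  obtain ⟨u, α⟩ := x
  obtain ⟨v, β⟩ := y
  obtain ⟨w, γ⟩ := z
  -- The three cyclic contractions of `ω` agree.
  have h1 : interior u (interior w (interior v om.form)) =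
      interior w (interior v (interior u om.form)) := by
    rw [interior_anticomm u w, interior_anticomm u v, map_neg, neg_neg]
  have h2 : interior v (interior u (interior w om.form)) =
      interior w (interior v (interior u om.form)) := by
    rw [interior_anticomm u w, map_neg, interior_anticomm v w, neg_neg]
  simp only [courantLinf, courantBracket, pairPlus, pairMinus, map_sub, map_smul,
    interior_lie_one, interior_d_function, h1, h2, vbracket_skew w v, vbracket_skew v u,
    vbracket_skew u w, map_neg, LinearMap.neg_apply]
  module

set_option maxHeartbeats 400000 in
/-- The coherence law of the Courant Lie 2-algebra. The terms in the 1-forms cancel by the Jacobi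
identity for vector fields; the terms in `ω` are exactly `cartan_of_closed`. -/
theorem courantLinf_jacobi_l3 (x y z t : VField E X × DForm E (⊤ : Opens X) 1) :
    (courantLinf om).act x ((courantLinf om).l3 y z t)
      - (courantLinf om).act y ((courantLinf om).l3 x z t)
      + (courantLinf om).act z ((courantLinf om).l3 x y t)
      - (courantLinf om).act t ((courantLinf om).l3 x y z) =
    (courantLinf om).l3 ((courantLinf om).l2 x y) z t
      - (courantLinf om).l3 ((courantLinf om).l2 x z) y t
      + (courantLinf om).l3 ((courantLinf om).l2 x t) y z
      + (courantLinf om).l3 ((courantLinf om).l2 y z) x t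
      - (courantLinf om).l3 ((courantLinf om).l2 y t) x z
      + (courantLinf om).l3 ((courantLinf om).l2 z t) x y := by
  simp only [courantLinf_l3]
  obtain ⟨u, α⟩ := x
  obtain ⟨v, β⟩ := y
  obtain ⟨w, γ⟩ := z
  obtain ⟨t, τ⟩ := t
  -- Contractions are sorted into a fixed order, those with brackets being applied first.
  have hb := fun (p q x : VField E X) => interior_anticomm (vbracket p q) x om.form
  have hb' := fun (p q x : VField E X) (b : DForm E (⊤ : Opens X) 2) =>
    interior_anticomm (vbracket p q) x b
  have huw := fun a : DForm E (⊤ : Opens X) 2 => interior_anticomm u w a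
  have hut := fun a : DForm E (⊤ : Opens X) 2 => interior_anticomm u t a
  have hvw := fun a : DForm E (⊤ : Opens X) 2 => interior_anticomm v w a
  have hvt := fun a : DForm E (⊤ : Opens X) 2 => interior_anticomm v t a
  have hwt := fun a : DForm E (⊤ : Opens X) 2 => interior_anticomm w t a
  have h := cartan_of_closed u v w t om.closed
  simp only [courantLinf, courantBracket, pairMinus, interior_d_function, interior_lie_one,
    map_sub, map_add, map_smul, map_neg, LinearMap.sub_apply, LinearMap.neg_apply,
    lie_vbracket,
    -- Brackets of two fields are put in the order `u, v, w, t`, and nested ones in a Jacobi basis.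
    vbracket_skew v u, vbracket_skew w u, vbracket_skew w v, vbracket_skew t u,
    vbracket_skew t v, vbracket_skew t w, vbracket_skew u (vbracket _ _),
    vbracket_skew v (vbracket _ _), vbracket_skew w (vbracket _ _),
    vbracket_skew t (vbracket _ _), vbracket_vbracket_cycle u v w, vbracket_vbracket_cycle u v t,
    vbracket_vbracket_cycle u w t, vbracket_vbracket_cycle v w t,
    hb, hb', huw, hut, hvw, hvt, hwt, interior_anticomm u v om.form,
    interior_anticomm u w om.form, interior_anticomm v w om.form]
  linear_combination (norm := module) h

theorem courantLinf_isLie2Algebra : (courantLinf om).IsLie2Algebra where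
  l2_linear y := by
    refine ⟨fun x x' => ?_, fun c x => ?_⟩ <;> refine Prod.ext ?_ ?_ <;>
      simp [courantLinf, courantBracket, pairMinus, vbracket_add_left, vbracket_smul_left] <;>
      module
  act_linear_left h := by
    refine ⟨fun x x' => ?_, fun c x => ?_⟩ <;> simp [courantLinf]
    all_goals module
  act_linear_right x := by
    refine ⟨fun x x' => ?_, fun c x => ?_⟩ <;> simp [courantLinf]
    all_goals module
  l3_linear y z := by
    refine ⟨fun x x' => ?_, fun c x => ?_⟩ <;> simp only [courantLinf_l3] <;>
      simp [vbracket_add_left, vbracket_smul_left, vbracket_add_right, vbracket_smul_right] <;>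
      module
  l2_skew x y := by
    refine Prod.ext (vbracket_skew _ _) ?_
    simp only [courantLinf, courantBracket, pairMinus, Prod.snd_neg]
    rw [interior_anticomm y.1 x.1, map_sub, map_sub]
    module
  l3_skew_left x y z := by
    rw [courantLinf_l3, courantLinf_l3, interior_anticomm x.1 y.1, vbracket_skew y.1 x.1,
      vbracket_skew z.1 y.1, vbracket_skew z.1 x.1]
    simp only [map_neg, LinearMap.neg_apply]
    module
  l3_skew_right x y z := by
    rw [courantLinf_l3, courantLinf_l3, interior_anticomm z.1 y.1, vbracket_skew y.1 x.1,
      vbracket_skew z.1 y.1, vbracket_skew z.1 x.1]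
    simp only [map_neg, LinearMap.neg_apply]
    module
  d_act x h := by
    refine Prod.ext ?_ ?_
    · simp [courantLinf, courantBracket, vbracket_zero_right]
    · simp [courantLinf, courantBracket, pairMinus, lie_d, interior_d_function]
      module
  act_d h k := by simp [courantLinf]
  jacobi x y z := by
    refine Prod.ext ?_ ?_
    · simpa [courantLinf, courantBracket] using vbracket_jacobi x.1 y.1 z.1
    · change d ((courantLinf om).l3 x y z) + (courantBracket om (courantBracket om x y) z).2
        + (courantBracket om (courantBracket om y z) x).2
        + (courantBracket om (courantBracket om z x) y).2 = 0
      rw [courantLinf_l3]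
      obtain ⟨u, α⟩ := x
      obtain ⟨v, β⟩ := y
      obtain ⟨w, γ⟩ := z
      simp only [courantBracket, pairMinus, map_sub, map_add, map_smul, map_neg,
        interior_lie_one, interior_d_function, vbracket_skew w v, vbracket_skew v u,
        vbracket_skew u w, LinearMap.neg_apply, lie_vbracket, lie_d]
      have h := d_interior_of_closed u v w om.closed
      have h1 : interior u (interior w (interior v om.form)) =
          interior w (interior v (interior u om.form)) := by
        rw [interior_anticomm u w, interior_anticomm u v, map_neg, neg_neg]
      have h2 : interior v (interior u (interior w om.form)) =
          interior w (interior v (interior u om.form)) := by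
        rw [interior_anticomm u w, map_neg, interior_anticomm v w, neg_neg]
      simp only [h1, h2]
      linear_combination (norm := module) -h
  jacobi_act x y h := by
    rw [courantLinf_l3]
    simp only [courantLinf, courantBracket, interior_d_function, map_smul, lie_vbracket]
    simp [vbracket_zero_left, vbracket_zero_right, interior_d_function, lie_vbracket]
    module
  jacobi_l3 x y z t := by
    exact courantLinf_jacobi_l3 om x y z t

end Courant

/-! ### The differential graded Lie algebras of infinitesimal symmetries -/

section Symmetries

variable {E X : Type*} [NormedAddCommGroup E] [NormedSpace ℝ E] [FiniteDimensional ℝ E]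
  [TopologicalSpace X] [ChartedSpace E X] [IsManifold 𝓘(ℝ, E) ∞ X]

section Brackets

variable {κ : Type*} {V : κ → Opens X} {k : ℕ}

/-- The component in the forms of the Jacobi identity of a semidirect product. -/
theorem famLie_jacobi (u v w : VField E X) (a b c : FormFamily E V k) :
    famLie (vbracket u v) c - famLie w (famLie u b - famLie v a) +
      (famLie (vbracket v w) a - famLie u (famLie v c - famLie w b)) +
      (famLie (vbracket w u) b - famLie v (famLie w a - famLie u c)) = 0 := by
  simp only [famLie_vbracket, map_sub]
  abel

end Brackets

variable {ι : Type*} {𝒰 : ι → Opens X} (A : DeligneCocycle E 𝒰)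

theorem dgLieQu_isLie2Algebra : (dgLieQu A).IsLie2Algebra where
  l2_linear y := by
    refine ⟨fun x x' => ?_, fun c x => ?_⟩ <;>
      refine Subtype.ext (Prod.ext ?_ (Prod.ext ?_ ?_)) <;>
      simp [dgLieQu, totBracket, vbracket_add_left, vbracket_smul_left] <;> module
  act_linear_left h := ⟨fun x y => LinearMap.map_add₂ famLie x.1.1 y.1.1 h,
    fun c x => LinearMap.map_smul₂ famLie c x.1.1 h⟩
  act_linear_right x := ⟨map_add (famLie x.1.1), map_smul (famLie x.1.1)⟩
  l3_linear y z := ⟨fun _ _ => (add_zero _).symm, fun _ _ => (smul_zero _).symm⟩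
  l2_skew x y := Subtype.ext (Prod.ext (vbracket_skew _ _)
    (Prod.ext (neg_sub _ _).symm (neg_sub _ _).symm))
  l3_skew_left x y z := neg_zero.symm
  l3_skew_right x y z := neg_zero.symm
  d_act x h := by
    refine Subtype.ext (Prod.ext ?_ (Prod.ext ?_ ?_)) <;>
      simp [dgLieQu, totBracket, vbracket_zero_right, dTot0, famLie_famD, famLie_cech0]
  act_d h k := by
    change famLie 0 k = -famLie 0 h
    simp
  jacobi x y z := by
    refine Subtype.ext (Prod.ext ?_ (Prod.ext ?_ ?_))
    · simpa [dgLieQu, totBracket] using vbracket_jacobi x.1.1 y.1.1 z.1.1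
    · simpa [dgLieQu, totBracket] using famLie_jacobi x.1.1 y.1.1 z.1.1 x.1.2.1 y.1.2.1 z.1.2.1
    · simpa [dgLieQu, totBracket] using famLie_jacobi x.1.1 y.1.1 z.1.1 x.1.2.2 y.1.2.2 z.1.2.2
  jacobi_act x y h := by
    simp only [dgLieQu, totBracket, famLie_vbracket]; abel
  jacobi_l3 x y z t := by simp [dgLieQu]

theorem dgLieCou_isLie2Algebra : (dgLieCou A).IsLie2Algebra where
  l2_linear y := by
    refine ⟨fun x x' => ?_, fun c x => ?_⟩ <;>
      refine Subtype.ext (Prod.ext ?_ (Prod.ext ?_ ?_)) <;>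
      simp [dgLieCou, totBracket, vbracket_add_left, vbracket_smul_left] <;> module
  act_linear_left h := ⟨fun x y => LinearMap.map_add₂ famLie x.1.1 y.1.1 h,
    fun c x => LinearMap.map_smul₂ famLie c x.1.1 h⟩
  act_linear_right x := ⟨map_add (famLie x.1.1), map_smul (famLie x.1.1)⟩
  l3_linear y z := ⟨fun _ _ => (add_zero _).symm, fun _ _ => (smul_zero _).symm⟩
  l2_skew x y := Subtype.ext (Prod.ext (vbracket_skew _ _)
    (Prod.ext (neg_sub _ _).symm (neg_sub _ _).symm))
  l3_skew_left x y z := neg_zero.symm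
  l3_skew_right x y z := neg_zero.symm
  d_act x h := by
    refine Subtype.ext (Prod.ext ?_ (Prod.ext ?_ ?_)) <;>
      simp [dgLieCou, totBracket, vbracket_zero_right, dTot0, famLie_famD, famLie_cech0]
  act_d h k := by
    change famLie 0 k = -famLie 0 h
    simp
  jacobi x y z := by
    refine Subtype.ext (Prod.ext ?_ (Prod.ext ?_ ?_))
    · simpa [dgLieCou, totBracket] using vbracket_jacobi x.1.1 y.1.1 z.1.1
    · simpa [dgLieCou, totBracket] using famLie_jacobi x.1.1 y.1.1 z.1.1 x.1.2.1 y.1.2.1 z.1.2.1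
    · simpa [dgLieCou, totBracket] using famLie_jacobi x.1.1 y.1.1 z.1.1 x.1.2.2 y.1.2.2 z.1.2.2
  jacobi_act x y h := by
    simp only [dgLieCou, totBracket, famLie_vbracket]; abel
  jacobi_l3 x y z t := by simp [dgLieCou]

theorem dgLieAt_isLie2Algebra : (dgLieAt A).IsLie2Algebra where
  l2_linear y := by
    refine ⟨fun x x' => ?_, fun c x => ?_⟩ <;>
      refine Subtype.ext (Prod.ext ?_ ?_) <;>
      simp [dgLieAt, vbracket_add_left, vbracket_smul_left] <;> module
  act_linear_left h := ⟨fun x y => LinearMap.map_add₂ famLie x.1.1 y.1.1 h,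
    fun c x => LinearMap.map_smul₂ famLie c x.1.1 h⟩
  act_linear_right x := ⟨map_add (famLie x.1.1), map_smul (famLie x.1.1)⟩
  l3_linear y z := ⟨fun _ _ => (add_zero _).symm, fun _ _ => (smul_zero _).symm⟩
  l2_skew x y := Subtype.ext (Prod.ext (vbracket_skew _ _) (neg_sub _ _).symm)
  l3_skew_left x y z := neg_zero.symm
  l3_skew_right x y z := neg_zero.symm
  d_act x h := by
    refine Subtype.ext (Prod.ext (vbracket_zero_right _).symm ?_)
    change cech0 (famLie x.1.1 h) = famLie x.1.1 (cech0 h) - famLie 0 x.1.2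
    simp [famLie_cech0]
  act_d h k := by
    change famLie 0 k = -famLie 0 h
    simp
  jacobi x y z := by
    refine Subtype.ext (Prod.ext ?_ ?_)
    · simpa [dgLieAt] using vbracket_jacobi x.1.1 y.1.1 z.1.1
    · simpa [dgLieAt] using famLie_jacobi x.1.1 y.1.1 z.1.1 x.1.2 y.1.2 z.1.2
  jacobi_act x y h := by
    simp only [dgLieAt, famLie_vbracket]; abel
  jacobi_l3 x y z t := by simp [dgLieAt]

theorem mapI_isMorphism : (mapI A).IsMorphism (dgLieQu A) (dgLieCou A) where
  f0_linear := ⟨fun _ _ => rfl, fun _ _ => rfl⟩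
  f1_linear := ⟨fun _ _ => rfl, fun _ _ => rfl⟩
  f2_linear _ := ⟨fun _ _ => (add_zero _).symm, fun _ _ => (smul_zero _).symm⟩
  f2_skew _ _ := neg_zero.symm
  comm _ := rfl
  bracket x y := (map_zero (dgLieCou A).d).trans (sub_self _).symm
  act x h := (sub_self _).symm
  l3 x y z := by simp [mapI, dgLieQu, dgLieCou]

theorem mapP_isMorphism : (mapP A).IsMorphism (dgLieCou A) (dgLieAt A) where
  f0_linear := ⟨fun _ _ => rfl, fun _ _ => rfl⟩
  f1_linear := ⟨fun _ _ => rfl, fun _ _ => rfl⟩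
  f2_linear _ := ⟨fun _ _ => (add_zero _).symm, fun _ _ => (smul_zero _).symm⟩
  f2_skew _ _ := neg_zero.symm
  comm _ := rfl
  bracket x y := (map_zero (dgLieAt A).d).trans (sub_self _).symm
  act x h := (sub_self _).symm
  l3 x y z := by simp [mapP, dgLieCou, dgLieAt]

end Symmetries

/-! ### The morphisms of the ladder -/

section Morphisms

variable {E X : Type*} [NormedAddCommGroup E] [NormedSpace ℝ E] [FiniteDimensional ℝ E]
  [TopologicalSpace X] [ChartedSpace E X] [IsManifold 𝓘(ℝ, E) ∞ X] {om : Pre2Plectic E X}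

open DForm

theorem pairMinus_linear_left (y : VField E X × DForm E (⊤ : Opens X) 1) :
    IsLinearMap ℝ fun x => pairMinus x y := by
  refine ⟨fun x x' => ?_, fun c x => ?_⟩ <;> simp [pairMinus] <;> module

theorem pairMinus_skew (x y : VField E X × DForm E (⊤ : Opens X) 1) :
    pairMinus x y = -pairMinus y x := (neg_sub _ _).symm

theorem interior_rotate (u v w : VField E X) {U : Opens X} {k : ℕ} (a : DForm E U (k + 3)) :
    interior u (interior w (interior v a)) = interior w (interior v (interior u a)) := by
  rw [interior_anticomm u w, interior_anticomm u v, map_neg, neg_neg]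

/-- On Hamiltonian pairs, `L_{v₁} H₂ - L_{v₂} H₁ = d (ι_{v₁} H₂ - ι_{v₂} H₁) + 2 ι_{v₁ ∧ v₂} ω`. -/
theorem lie_sub_lie_of_mem_hamPairs (x y : hamPairs om) :
    lie x.1.1 y.1.2 - lie y.1.1 x.1.2 =
      d (pairMinus x.1 y.1) + (2 : ℝ) • interior y.1.1 (interior x.1.1 om.form) := by
  have hx : d x.1.2 = -interior x.1.1 om.form := eq_neg_of_add_eq_zero_right x.2
  have hy : d y.1.2 = -interior y.1.1 om.form := eq_neg_of_add_eq_zero_right y.2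
  rw [lie_succ, lie_succ, hx, hy, map_neg, map_neg, interior_anticomm x.1.1 y.1.1, pairMinus,
    map_sub]
  module

/-- The pairing of Hamiltonian pairs is closed for the Chevalley-Eilenberg differential: the
contributions of the curvature and of the exterior derivatives of the 1-forms cancel. -/
theorem pairMinus_cyclic (x y z : hamPairs om) :
    (pairMinus x.1 ((hamLinf om).l2 y z).1 + lie x.1.1 (pairMinus y.1 z.1)) +
    (pairMinus y.1 ((hamLinf om).l2 z x).1 + lie y.1.1 (pairMinus z.1 x.1)) +
    (pairMinus z.1 ((hamLinf om).l2 x y).1 + lie z.1.1 (pairMinus x.1 y.1)) = 0 := by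
  have hd : ∀ (x y z : hamPairs om), -interior z.1.1 (interior y.1.1 (interior x.1.1 om.form)) =
      lie y.1.1 (interior z.1.1 x.1.2) - lie z.1.1 (interior y.1.1 x.1.2) -
        interior (vbracket y.1.1 z.1.1) x.1.2 := by
    intro x y z
    have hx : d x.1.2 = -interior x.1.1 om.form := eq_neg_of_add_eq_zero_right x.2
    rw [← interior_interior_d, hx, map_neg, map_neg]
  have h1 := hd x y z
  have h2 := hd y z x
  have h3 := hd z x y
  simp only [hamLinf, pairMinus, map_sub]
  linear_combination (norm := module) -h1 - h2 - h3

theorem mapPhi_isMorphism : (mapPhi om).IsMorphism (hamLinf om) (courantLinf om) where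
  f0_linear := ⟨fun _ _ => rfl, fun _ _ => rfl⟩
  f1_linear := ⟨fun _ _ => rfl, fun _ _ => rfl⟩
  f2_linear y := by
    refine ⟨fun x x' => ?_, fun c x => ?_⟩
    · simp only [mapPhi, Submodule.coe_add, (pairMinus_linear_left y.1).map_add]; module
    · simp only [mapPhi, Submodule.coe_smul, (pairMinus_linear_left y.1).map_smul]; module
  f2_skew x y := by
    simp only [mapPhi]; rw [pairMinus_skew]; module
  comm _ := rfl
  bracket x y := by
    refine Prod.ext ?_ ?_
    · simp [courantLinf, mapPhi, hamLinf, courantBracket]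
    · change d (-((1 / 2 : ℝ) • pairMinus x.1 y.1)) = interior y.1.1 (interior x.1.1 om.form) -
        (lie x.1.1 y.1.2 - lie y.1.1 x.1.2 - (1 / 2 : ℝ) • d (pairMinus x.1 y.1) -
          interior y.1.1 (interior x.1.1 om.form))
      rw [lie_sub_lie_of_mem_hamPairs, map_neg, map_smul]
      module
  act x h := by
    simp [mapPhi, hamLinf, courantLinf, pairMinus]
  l3 x y z := by
    rw [courantLinf_l3]
    simp only [mapPhi, hamLinf, courantLinf, pairMinus, interior_d_function, map_sub, map_smul,
      map_neg, interior_rotate x.1.1 y.1.1 z.1.1, interior_rotate y.1.1 z.1.1 x.1.1]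
    module

theorem mapPsi_isMorphism : mapPsi.IsMorphism (courantLinf om) (atiyahLinf om) where
  f0_linear := ⟨fun _ _ => rfl, fun _ _ => rfl⟩
  f1_linear := ⟨fun _ _ => rfl, fun _ _ => rfl⟩
  f2_linear y := by
    refine ⟨fun x x' => ?_, fun c x => ?_⟩
    · simp only [mapPsi, (pairMinus_linear_left y).map_add]; module
    · simp only [mapPsi, (pairMinus_linear_left y).map_smul]; module
  f2_skew x y := by
    simp only [mapPsi]; rw [pairMinus_skew]; module
  comm _ := rfl
  bracket x y := (sub_self _).symm
  act x h := by
    simp [mapPsi, courantLinf, atiyahLinf, pairMinus, interior_d_function]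
    module
  l3 x y z := by
    rw [courantLinf_l3]
    simp only [mapPsi, atiyahLinf, courantLinf, courantBracket, pairMinus, interior_d_function,
      interior_lie_one, map_sub, map_smul,
      map_neg, interior_rotate x.1 y.1 z.1, interior_rotate y.1 z.1 x.1,
      vbracket_skew y.1 x.1, vbracket_skew z.1 y.1, vbracket_skew x.1 z.1, LinearMap.neg_apply]
    module

variable {ι : Type*} {𝒰 : ι → Opens X} {A : DeligneCocycle E 𝒰}

theorem contractA2_skew (u v : VField E X) : contractA2 A u v = -contractA2 A v u :=
  famInterior_anticomm _ _ _

theorem contractA2_add_left (u u' v : VField E X) :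
    contractA2 A (u + u') v = contractA2 A u v + contractA2 A u' v := by
  simp [contractA2]

theorem contractA2_smul_left (c : ℝ) (u v : VField E X) :
    contractA2 A (c • u) v = c • contractA2 A u v := by
  simp [contractA2]

/-- The curvature identity `d A² = ω`, evaluated on three vector fields. -/
theorem DeligneCocycle.Prequantizes.contractA2_cyclic (hA : A.Prequantizes om.form)
    (u v w : VField E X) :
    (famLie u (contractA2 A v w) - contractA2 A (vbracket v w) u) +
    (famLie v (contractA2 A w u) - contractA2 A (vbracket w u) v) +
    (famLie w (contractA2 A u v) - contractA2 A (vbracket u v) w) =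
      famRes 𝒰 (interior w (interior v (interior u om.form))) := by
  rw [← famInterior_famRes, ← famInterior_famRes, ← famInterior_famRes,
    ← show famD A.A2 = famRes 𝒰 om.form from hA, famInterior_interior_interior_d,
    contractA2_skew (vbracket v w), contractA2_skew (vbracket w u), contractA2_skew (vbracket u v)]
  simp only [contractA2]
  abel

/-- The Čech component of the failure of `v ↦ -ι_v A¹` to respect brackets. -/
theorem cech0_contractA2 (u v : VField E X) :
    cech0 (contractA2 A u v) = -famInterior (vbracket u v) A.A1 -
      (famLie u (-famInterior v A.A1) - famLie v (-famInterior u A.A1)) := by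
  rw [contractA2, ← famInterior_cech0, ← famInterior_cech0, A.cocycle2, famInterior_vbracket,
    famLie_succ u A.A1, map_add, map_neg, map_neg, famLie_zero v]
  abel

/-- The de Rham component of the failure of `v ↦ ι_v A²` to respect brackets. -/
theorem DeligneCocycle.Prequantizes.famD_contractA2 (hA : A.Prequantizes om.form) (u v : VField E X) :
    famD (contractA2 A u v) = famRes 𝒰 (interior v (interior u om.form)) +
      famInterior (vbracket u v) A.A2 -
      (famLie u (famInterior v A.A2) - famLie v (famInterior u A.A2)) := by
  rw [← famInterior_famRes, ← famInterior_famRes, ← show famD A.A2 = famRes 𝒰 om.form from hA,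
    famInterior_vbracket, famLie_succ u A.A2, map_add, famLie_succ v (famInterior u A.A2),
    contractA2]
  abel

theorem mapF_isMorphism (hA : A.Prequantizes om.form) :
    (mapF hA).IsMorphism (hamLinf om) (dgLieQu A) where
  f0_linear := by
    refine ⟨fun x x' => ?_, fun c x => ?_⟩ <;>
      refine Subtype.ext (Prod.ext ?_ (Prod.ext ?_ ?_)) <;> simp [mapF]
    all_goals module
  f1_linear := by
    refine ⟨fun x x' => ?_, fun c x => ?_⟩ <;> simp [mapF]
    all_goals module
  f2_linear y := by
    refine ⟨fun x x' => ?_, fun c x => ?_⟩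
    · simp only [mapF, Submodule.coe_add, (pairMinus_linear_left y.1).map_add, Prod.fst_add,
        contractA2_add_left, map_add]
      module
    · simp only [mapF, Submodule.coe_smul, (pairMinus_linear_left y.1).map_smul, Prod.smul_fst,
        contractA2_smul_left, map_smul]
      module
  f2_skew x y := by
    simp only [mapF]; rw [pairMinus_skew, contractA2_skew, map_neg]; abel
  comm h := by
    refine Subtype.ext (Prod.ext ?_ (Prod.ext ?_ ?_)) <;>
      simp [mapF, hamLinf, dgLieQu, dTot0, famD_famRes, cech0_famRes]
  bracket x y := by
    refine Subtype.ext (Prod.ext ?_ (Prod.ext ?_ ?_))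
    · exact (sub_self _).symm
    · change famD (famRes 𝒰 (pairMinus x.1 y.1) + contractA2 A x.1.1 y.1.1) =
        -famRes 𝒰 (interior y.1.1 (interior x.1.1 om.form)) +
          famInterior (vbracket x.1.1 y.1.1) A.A2 -
        (famLie x.1.1 (-famRes 𝒰 y.1.2 + famInterior y.1.1 A.A2) -
          famLie y.1.1 (-famRes 𝒰 x.1.2 + famInterior x.1.1 A.A2))
      have h := congrArg (famRes 𝒰) (lie_sub_lie_of_mem_hamPairs x y)
      simp only [map_sub, map_add, map_smul] at h
      simp only [map_add, map_neg, famLie_famRes, famD_famRes, hA.famD_contractA2]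
      linear_combination (norm := module) -h
    · change cech0 (famRes 𝒰 (pairMinus x.1 y.1) + contractA2 A x.1.1 y.1.1) = _
      rw [map_add, cech0_famRes, zero_add, cech0_contractA2]
      rfl
  act x h := by
    change famRes 𝒰 (pairMinus x.1 (0, d h)) + contractA2 A x.1.1 0 =
      -famRes 𝒰 0 - famLie x.1.1 (-famRes 𝒰 h)
    simp [contractA2, pairMinus, famLie_famRes, interior_d_function]
  l3 x y z := by
    have h := hA.contractA2_cyclic x.1.1 y.1.1 z.1.1
    have hp := congrArg (famRes 𝒰) (pairMinus_cyclic x y z)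
    rw [map_zero] at hp
    simp only [map_add, ← famLie_famRes] at hp
    change -famRes 𝒰 (-interior z.1.1 (interior y.1.1 (interior x.1.1 om.form))) - 0 =
      (famRes 𝒰 (pairMinus x.1 ((hamLinf om).l2 y z).1) +
          contractA2 A x.1.1 (vbracket y.1.1 z.1.1) +
        famLie x.1.1 (famRes 𝒰 (pairMinus y.1 z.1) + contractA2 A y.1.1 z.1.1)) +
      (famRes 𝒰 (pairMinus y.1 ((hamLinf om).l2 z x).1) +
          contractA2 A y.1.1 (vbracket z.1.1 x.1.1) +
        famLie y.1.1 (famRes 𝒰 (pairMinus z.1 x.1) + contractA2 A z.1.1 x.1.1)) +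
      (famRes 𝒰 (pairMinus z.1 ((hamLinf om).l2 x y).1) +
          contractA2 A z.1.1 (vbracket x.1.1 y.1.1) +
        famLie z.1.1 (famRes 𝒰 (pairMinus x.1 y.1) + contractA2 A x.1.1 y.1.1))
    rw [contractA2_skew x.1.1, contractA2_skew y.1.1 (vbracket _ _),
      contractA2_skew z.1.1 (vbracket _ _)]
    simp only [map_add, map_neg]
    linear_combination (norm := module) -h - hp

theorem mapFc_isMorphism (hA : A.Prequantizes om.form) :
    (mapFc A).IsMorphism (courantLinf om) (dgLieCou A) where
  f0_linear := by
    refine ⟨fun x x' => ?_, fun c x => ?_⟩ <;>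
      refine Subtype.ext (Prod.ext ?_ (Prod.ext ?_ ?_)) <;> simp [mapFc]
    all_goals module
  f1_linear := by
    refine ⟨fun x x' => ?_, fun c x => ?_⟩ <;> simp [mapFc]
    all_goals module
  f2_linear y := by
    refine ⟨fun x x' => ?_, fun c x => ?_⟩
    · simp only [mapFc, (pairMinus_linear_left y).map_add, Prod.fst_add,
        contractA2_add_left, map_add]
      module
    · simp only [mapFc, (pairMinus_linear_left y).map_smul, Prod.smul_fst,
        contractA2_smul_left, map_smul]
      module
  f2_skew x y := by
    simp only [mapFc]; rw [pairMinus_skew, contractA2_skew, map_neg]; module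
  comm h := by
    refine Subtype.ext (Prod.ext ?_ (Prod.ext ?_ ?_)) <;>
      simp [mapFc, courantLinf, dgLieCou, dTot0, famD_famRes, cech0_famRes]
  bracket x y := by
    refine Subtype.ext (Prod.ext ?_ (Prod.ext ?_ ?_))
    · exact (sub_self _).symm
    · change famD ((1 / 2 : ℝ) • famRes 𝒰 (pairMinus x y) + contractA2 A x.1 y.1) =
        -famRes 𝒰 (courantBracket om x y).2 +
          famInterior (vbracket x.1 y.1) A.A2 -
        (famLie x.1 (-famRes 𝒰 y.2 + famInterior y.1 A.A2) -
          famLie y.1 (-famRes 𝒰 x.2 + famInterior x.1 A.A2))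
      simp only [courantBracket, map_add, map_sub, map_smul, map_neg, famLie_famRes, famD_famRes,
        hA.famD_contractA2]
      module
    · change cech0 ((1 / 2 : ℝ) • famRes 𝒰 (pairMinus x y) + contractA2 A x.1 y.1) = _
      rw [map_add, map_smul, cech0_famRes, smul_zero, zero_add, cech0_contractA2]
      rfl
  act x h := by
    change (1 / 2 : ℝ) • famRes 𝒰 (pairMinus x (0, d h)) + contractA2 A x.1 0 =
      -famRes 𝒰 ((1 / 2 : ℝ) • interior x.1 (d h)) - famLie x.1 (-famRes 𝒰 h)
    simp [contractA2, pairMinus, famLie_famRes, interior_d_function]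
    module
  l3 x y z := by
    have h := hA.contractA2_cyclic x.1 y.1 z.1
    rw [courantLinf_l3]
    simp only [mapFc, dgLieCou, courantLinf, courantBracket, pairMinus, interior_d_function,
      interior_lie_one, map_sub, map_add, map_smul, famLie_famRes,
      map_neg, interior_rotate x.1 y.1 z.1, interior_rotate y.1 z.1 x.1,
      contractA2_skew x.1 (vbracket _ _), contractA2_skew y.1 (vbracket _ _),
      contractA2_skew z.1 (vbracket _ _),
      vbracket_skew y.1 x.1, vbracket_skew z.1 y.1, vbracket_skew x.1 z.1, LinearMap.neg_apply]
    linear_combination (norm := module) -h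

theorem mapFa_isMorphism (hA : A.Prequantizes om.form) :
    (mapFa A).IsMorphism (atiyahLinf om) (dgLieAt A) where
  f0_linear := by
    refine ⟨fun x x' => ?_, fun c x => ?_⟩ <;>
      refine Subtype.ext (Prod.ext ?_ ?_) <;> simp [mapFa]
    all_goals module
  f1_linear := by
    refine ⟨fun x x' => ?_, fun c x => ?_⟩ <;> simp [mapFa]
    all_goals module
  f2_linear y := ⟨fun _ _ => contractA2_add_left _ _ _, fun _ _ => contractA2_smul_left _ _ _⟩
  f2_skew x y := contractA2_skew x y
  comm h := by
    refine Subtype.ext (Prod.ext rfl ?_)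
    change -famInterior 0 A.A1 = cech0 (-famRes 𝒰 h)
    simp [cech0_famRes]
  bracket x y := by
    refine Subtype.ext (Prod.ext ?_ ?_)
    · exact (sub_self _).symm
    · exact cech0_contractA2 x y
  act x h := by
    change contractA2 A x 0 = -famRes 𝒰 (lie x h) - famLie x (-famRes 𝒰 h)
    simp [contractA2, famLie_famRes]
  l3 x y z := by
    have h := hA.contractA2_cyclic x y z
    simp only [mapFa, dgLieAt, atiyahLinf, map_neg, contractA2_skew x (vbracket _ _),
      contractA2_skew y (vbracket _ _), contractA2_skew z (vbracket _ _)]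
    linear_combination (norm := module) -h

end Morphisms

/-! ### Weak equivalences and commutativity -/

section Ladder

variable {E X : Type*} [NormedAddCommGroup E] [NormedSpace ℝ E] [FiniteDimensional ℝ E]
  [TopologicalSpace X] [ChartedSpace E X] [IsManifold 𝓘(ℝ, E) ∞ X] {om : Pre2Plectic E X}
  {ι : Type*} {𝒰 : ι → Opens X} {A : DeligneCocycle E 𝒰}

open DForm

theorem mapFc_comp_mapPhi (hA : A.Prequantizes om.form) :
    (mapFc A).comp (mapPhi om) = (mapI A).comp (mapF hA) := by
  refine TwoTermMap.ext rfl rfl (funext fun x => funext fun y => ?_)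
  change -famRes 𝒰 (-((1 / 2 : ℝ) • pairMinus x.1 y.1)) +
      ((1 / 2 : ℝ) • famRes 𝒰 (pairMinus x.1 y.1) + contractA2 A x.1.1 y.1.1) =
    famRes 𝒰 (pairMinus x.1 y.1) + contractA2 A x.1.1 y.1.1 + 0
  rw [map_neg, map_smul]
  module

theorem mapFa_comp_mapPsi : (mapFa A).comp mapPsi = (mapP A).comp (mapFc A) := by
  refine TwoTermMap.ext rfl rfl (funext fun x => funext fun y => ?_)
  change -famRes 𝒰 (-((1 / 2 : ℝ) • pairMinus x y)) + contractA2 A x.1 y.1 =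
    (1 / 2 : ℝ) • famRes 𝒰 (pairMinus x y) + contractA2 A x.1 y.1 + 0
  rw [map_neg, map_smul]
  module

/-- A lift `θ⁰` of a vector field to an infinitesimal symmetry agrees with the lift `-ι_v A¹` up to
a Čech coboundary. -/
theorem exists_cech0_eq_of_mem_atPairs [T2Space X] [SecondCountableTopology X]
    (h𝒰 : ⨆ i, 𝒰 i = ⊤) {p : VField E X × FormFamily E (inter2 𝒰) 0} (hp : p ∈ atPairs A) :
    ∃ k : FormFamily E 𝒰 0, p.2 = -famInterior p.1 A.A1 + cech0 k := by
  rw [mem_atPairs, A.dlogA0_eq, map_neg, famInterior_cech1] at hp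
  obtain ⟨k, hk⟩ := exists_cech0_eq h𝒰 (c := p.2 + famInterior p.1 A.A1)
    (by rw [map_add, ← hp]; abel)
  exact ⟨k, by rw [hk]; abel⟩

/-- An infinitesimal symmetry `v + θ¹ + θ⁰` agrees up to a coboundary with `v - θ + ι_v (A² - A¹)`,
for some global 1-form `θ`. -/
theorem exists_eq_of_mem_couPairs [T2Space X] [SecondCountableTopology X]
    (h𝒰 : ⨆ i, 𝒰 i = ⊤) {p : VTot1 (E := E) 𝒰} (hp : p ∈ couPairs A) :
    ∃ (θ : DForm E (⊤ : Opens X) 1) (k : FormFamily E 𝒰 0),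
      p.2.1 = -famRes 𝒰 θ + famInterior p.1 A.A2 + famD k ∧
      p.2.2 = -famInterior p.1 A.A1 + cech0 k := by
  rw [mem_couPairs] at hp
  obtain ⟨k, hk⟩ := exists_cech0_eq_of_mem_atPairs h𝒰 hp.2
  have hk : p.2.2 = -famInterior p.1 A.A1 + cech0 k := hk
  -- `δ θ¹ = L_v A¹ + d θ⁰`, and both `δ A² = d A¹` and the choice of `k` make the rest a cocycle.
  obtain ⟨θ, hθ⟩ := exists_neg_famRes_eq h𝒰 (a := p.2.1 - famInterior p.1 A.A2 - famD k) (by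
    have h1 : cech0 p.2.1 = famLie p.1 A.A1 + famD p.2.2 := by rw [hp.1]; abel
    rw [map_sub, map_sub, h1, hk, ← famInterior_cech0, A.cocycle2, ← famD_cech0, famLie_succ,
      map_add, map_neg]
    abel)
  exact ⟨θ, k, by rw [hθ]; abel, hk⟩

/-- A global 1-form whose restriction is `d k` for a Čech 0-cocycle `k` is exact. -/
theorem exists_d_eq (h𝒰 : ⨆ i, 𝒰 i = ⊤) {θ : DForm E (⊤ : Opens X) 1} {k : FormFamily E 𝒰 0}
    (hk : cech0 k = 0) (hθ : famD k = -famRes 𝒰 θ) : ∃ h, d h = θ := by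
  obtain ⟨h, rfl⟩ := exists_neg_famRes_eq h𝒰 hk
  refine ⟨h, famRes_injective h𝒰 ?_⟩
  rw [map_neg, famD_famRes] at hθ
  exact neg_injective hθ

/-- A global function whose restriction is locally constant is locally constant. -/
theorem d_eq_zero_of_famD (h𝒰 : ⨆ i, 𝒰 i = ⊤) {h : DForm E (⊤ : Opens X) 0}
    (hh : famD (-famRes 𝒰 h) = 0) : d h = 0 := by
  rw [map_neg, famD_famRes] at hh
  exact eq_zero_of_neg_famRes_eq_zero h𝒰 hh

variable [T2Space X] [SecondCountableTopology X]

theorem mapF_isWeakEquivalence (h𝒰 : ⨆ i, 𝒰 i = ⊤) (hA : A.Prequantizes om.form) :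
    (mapF hA).IsWeakEquivalence (hamLinf om) (dgLieQu A) where
  toIsMorphism := mapF_isMorphism hA
  injective_H1 _ _ hh := eq_zero_of_neg_famRes_eq_zero h𝒰 hh
  surjective_H1 k hk := by
    have hk' : (0, famD k, cech0 k) = (0 : VTot1 (E := E) 𝒰) := congrArg Subtype.val hk
    simp only [Prod.ext_iff] at hk'
    obtain ⟨h, rfl⟩ := exists_neg_famRes_eq h𝒰 hk'.2.2
    exact ⟨h, Subtype.ext (Prod.ext rfl (d_eq_zero_of_famD h𝒰 hk'.2.1)), rfl⟩
  injective_H0 := by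
    rintro ⟨⟨v, θ⟩, hx⟩ ⟨k, hk⟩
    have hk' : ((0, famD k, cech0 k) : VTot1 (E := E) 𝒰) =
      (v, -famRes 𝒰 θ + famInterior v A.A2, -famInterior v A.A1) := congrArg Subtype.val hk
    simp only [Prod.mk.injEq] at hk'
    obtain ⟨rfl, h1, h2⟩ := hk'
    rw [map_zero, LinearMap.zero_apply] at h1 h2
    rw [add_zero] at h1
    rw [neg_zero] at h2
    obtain ⟨h, rfl⟩ := exists_d_eq h𝒰 h2 h1
    exact ⟨h, rfl⟩
  surjective_H0 := by
    rintro ⟨⟨v, θ₁, θ₀⟩, hy⟩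
    have hy' := (mem_quPairs A).1 hy
    obtain ⟨θ, k, h1, h2⟩ := exists_eq_of_mem_couPairs h𝒰 hy'.2
    -- `L_v A² = d θ₁ = -dθ + d ι_v A²` and `d A² = ω` give `ι_v ω + dθ = 0`.
    have hθ : (v, θ) ∈ hamPairs om := by
      rw [mem_hamPairs]
      apply famRes_injective h𝒰
      have h := hy'.1
      simp only at h h1
      rw [h1, map_add, map_add, map_neg, famD_famD, famD_famRes, famLie_succ,
        show famD A.A2 = famRes 𝒰 om.form from hA, famInterior_famRes] at h
      rw [map_zero, map_add]
      linear_combination (norm := module) h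
    exact ⟨⟨(v, θ), hθ⟩, k, Subtype.ext (Prod.ext (add_zero v).symm (Prod.ext h1 h2))⟩

theorem mapFc_isWeakEquivalence (h𝒰 : ⨆ i, 𝒰 i = ⊤) (hA : A.Prequantizes om.form) :
    (mapFc A).IsWeakEquivalence (courantLinf om) (dgLieCou A) where
  toIsMorphism := mapFc_isMorphism hA
  injective_H1 _ _ hh := eq_zero_of_neg_famRes_eq_zero h𝒰 hh
  surjective_H1 k hk := by
    have hk' : (0, famD k, cech0 k) = (0 : VTot1 (E := E) 𝒰) := congrArg Subtype.val hk
    simp only [Prod.ext_iff] at hk'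
    obtain ⟨h, rfl⟩ := exists_neg_famRes_eq h𝒰 hk'.2.2
    exact ⟨h, Prod.ext rfl (d_eq_zero_of_famD h𝒰 hk'.2.1), rfl⟩
  injective_H0 := by
    rintro ⟨v, θ⟩ ⟨k, hk⟩
    have hk' : ((0, famD k, cech0 k) : VTot1 (E := E) 𝒰) =
      (v, -famRes 𝒰 θ + famInterior v A.A2, -famInterior v A.A1) := congrArg Subtype.val hk
    simp only [Prod.mk.injEq] at hk'
    obtain ⟨rfl, h1, h2⟩ := hk'
    rw [map_zero, LinearMap.zero_apply] at h1 h2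
    rw [add_zero] at h1
    rw [neg_zero] at h2
    obtain ⟨h, rfl⟩ := exists_d_eq h𝒰 h2 h1
    exact ⟨h, rfl⟩
  surjective_H0 := by
    rintro ⟨⟨v, θ₁, θ₀⟩, hy⟩
    obtain ⟨θ, k, h1, h2⟩ := exists_eq_of_mem_couPairs h𝒰 hy
    exact ⟨(v, θ), k, Subtype.ext (Prod.ext (add_zero v).symm (Prod.ext h1 h2))⟩

theorem mapFa_isWeakEquivalence (h𝒰 : ⨆ i, 𝒰 i = ⊤) (hA : A.Prequantizes om.form) :
    (mapFa A).IsWeakEquivalence (atiyahLinf om) (dgLieAt A) where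
  toIsMorphism := mapFa_isMorphism hA
  injective_H1 _ _ hh := eq_zero_of_neg_famRes_eq_zero h𝒰 hh
  surjective_H1 k hk := by
    have hk' : (0, cech0 k) = (0 : VField E X × FormFamily E (inter2 𝒰) 0) :=
      congrArg Subtype.val hk
    obtain ⟨h, rfl⟩ := exists_neg_famRes_eq h𝒰 (congrArg Prod.snd hk')
    exact ⟨h, rfl, rfl⟩
  injective_H0 v := by
    rintro ⟨k, hk⟩
    exact ⟨0, congrArg (fun p : atPairs A => p.1.1) hk⟩
  surjective_H0 := by
    rintro ⟨⟨v, θ₀⟩, hy⟩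
    obtain ⟨k, hk⟩ := exists_cech0_eq_of_mem_atPairs h𝒰 hy
    exact ⟨v, k, Subtype.ext (Prod.ext (add_zero v).symm hk)⟩

end Ladder

end HigherPrequantum

theorem mainTheorem6 {E X : Type*} [NormedAddCommGroup E] [NormedSpace ℝ E]
    [FiniteDimensional ℝ E] [TopologicalSpace X] [T2Space X] [SecondCountableTopology X]
    [ChartedSpace E X] [IsManifold 𝓘(ℝ, E) ∞ X] {ι : Type*} (𝒰 : ι → Opens X)
    (h𝒰 : ⨆ i, 𝒰 i = ⊤) (om : Pre2Plectic E X) (A : DeligneCocycle E 𝒰)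
    (hA : A.Prequantizes om.form) :
    ((hamLinf om).IsLie2Algebra ∧ (courantLinf om).IsLie2Algebra ∧ (atiyahLinf om).IsLie2Algebra ∧
      (dgLieQu A).IsLie2Algebra ∧ (dgLieCou A).IsLie2Algebra ∧ (dgLieAt A).IsLie2Algebra) ∧
    ((mapPhi om).IsMorphism (hamLinf om) (courantLinf om) ∧
      mapPsi.IsMorphism (courantLinf om) (atiyahLinf om) ∧
      (mapI A).IsMorphism (dgLieQu A) (dgLieCou A) ∧
      (mapP A).IsMorphism (dgLieCou A) (dgLieAt A)) ∧
    (mapF hA).IsWeakEquivalence (hamLinf om) (dgLieQu A) ∧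
    (mapFc A).IsWeakEquivalence (courantLinf om) (dgLieCou A) ∧
    (mapFa A).IsWeakEquivalence (atiyahLinf om) (dgLieAt A) ∧
    (mapFc A).comp (mapPhi om) = (mapI A).comp (mapF hA) ∧
    (mapFa A).comp mapPsi = (mapP A).comp (mapFc A) :=
  ⟨⟨hamLinf_isLie2Algebra om, courantLinf_isLie2Algebra om, atiyahLinf_isLie2Algebra om,
      dgLieQu_isLie2Algebra A, dgLieCou_isLie2Algebra A, dgLieAt_isLie2Algebra A⟩,
    ⟨mapPhi_isMorphism, mapPsi_isMorphism, mapI_isMorphism A, mapP_isMorphism A⟩,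
    mapF_isWeakEquivalence h𝒰 hA, mapFc_isWeakEquivalence h𝒰 hA, mapFa_isWeakEquivalence h𝒰 hA,
    mapFc_comp_mapPhi hA, mapFa_comp_mapPsi⟩
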